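/- Let $(M_0^{n_0},g_0)$ and $(M_1^{n_1},g_1)$ be smooth Riemannian manifolds of dimensions $n_0,n_1\ge 2$, let $n=n_0+n_1$, and let $M^n=M_0\times M_1$ carry the product metric $g=\pi_0^*g_0+\pi_1^*g_1$. Let $f\colon M^n\to\mathbb{R}^{n+1}$ be a smooth conformal immersion, that is, there is a smooth function $\varphi\colon M\to(0,\infty)$ with $\langle df(X),df(Y)\rangle=\varphi^2 g(X,Y)$ for all tangent vectors $X,Y$ at the same point. Let $\alpha^f$ be the second fundamental form of $f$ (for the metric on $M$ induced by $f$), so that $\alpha^f(X,Y)$ is the component of $D_X\,df(Y)$ normal to $f$, where $D$ is the standard derivative of $\mathbb{R}^{n+1}$. Let $x=(x_0,x_1)\in M$ and suppose that there are two-dimensional planes $V_0\subset T_{x_0}M_0$ and $V_1\subset T_{x_1}M_1$ with $$K_0+K_1\neq 0,$$ where $K_i$ is the sectional curvature of $V_i$ in $(M_i,g_i)$. Then $\alpha^f$ is adapted to the product net of $M$ at $x$: $\alpha^f(X_0,X_1)=0$ for all $X_0\in T_{x_0}M_0$ and $X_1\in T_{x_1}M_1$, both regarded as vectors of $T_xM=T_{x_0}M_0\oplus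 T_{x_1}M_1$. -/

import Mathlib

open scoped Manifold ContDiff

noncomputable section

namespace ConformalProduct

section LocalRiemannian

/-! Riemannian geometry of a metric `G` on (an open subset of) a vector space `E`, that is, of the
expression of a Riemannian metric in a chart. -/

variable {E : Type*} [NormedAddCommGroup E] [NormedSpace ℝ E]

/-- Christoffel symbols of the first kind: `christoffelFirst G y X Y Z` is
`½ (∂_X G(Y,Z) + ∂_Y G(X,Z) - ∂_Z G(X,Y))` at `y`, as a linear form in `Z`. -/
def christoffelFirst (G : E → E →L[ℝ] E →L[ℝ] ℝ) (y X Y : E) : E →L[ℝ] ℝ :=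
  (1 / 2 : ℝ) •
    (fderiv ℝ G y X Y + fderiv ℝ G y Y X - ((fderiv ℝ G y).flip X).flip Y)

/-- Christoffel symbols of the second kind: `christoffel G y X Y` is the covariant derivative at
`y`, for the Levi-Civita connection of `G`, of the constant field `Y` in the direction `X`. Here
`(G y).inverse` is the inverse of the isomorphism `E → E*`, `v ↦ G y v ·`. -/
def christoffel (G : E → E →L[ℝ] E →L[ℝ] ℝ) (y X Y : E) : E :=
  (G y).inverse (christoffelFirst G y X Y)

/-- The curvature `R(X,Y)Z = ∇_X ∇_Y Z - ∇_Y ∇_X Z` at `y`, for constant `X`, `Y`, `Z`. -/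
def localCurvature (G : E → E →L[ℝ] E →L[ℝ] ℝ) (y X Y Z : E) : E :=
  fderiv ℝ (fun z => christoffel G z Y Z) y X - fderiv ℝ (fun z => christoffel G z X Z) y Y
    + christoffel G y X (christoffel G y Y Z) - christoffel G y Y (christoffel G y X Z)

end LocalRiemannian

section Intrinsic

variable {n : ℕ} {M : Type*} [TopologicalSpace M] [ChartedSpace (EuclideanSpace ℝ (Fin n)) M]
  [IsManifold (𝓡 n) ∞ M]

/-- The differential at `y` of the inverse of the preferred chart at `x`; both `T_y E` and
`T_p M`, `p` the image of `y`, are copies of `E = EuclideanSpace ℝ (Fin n)`. -/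
def chartSymmDeriv (x : M) (y : EuclideanSpace ℝ (Fin n)) :
    EuclideanSpace ℝ (Fin n) →L[ℝ] EuclideanSpace ℝ (Fin n) :=
  mfderiv 𝓘(ℝ, EuclideanSpace ℝ (Fin n)) (𝓡 n) (extChartAt (𝓡 n) x).symm y

/-- The Riemannian metric on `T_p M`, as a bilinear form on `E`, of which `T_p M` is a copy. -/
def metricAt
    (g : Bundle.ContMDiffRiemannianMetric (𝓡 n) ∞ (EuclideanSpace ℝ (Fin n))
      (fun p : M => TangentSpace (𝓡 n) p)) (p : M) :
    EuclideanSpace ℝ (Fin n) →L[ℝ] EuclideanSpace ℝ (Fin n) →L[ℝ] ℝ :=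
  g.inner p

/-- The expression of the Riemannian metric `g` in the preferred chart at `x`: the pullback of `g`
under the inverse of the chart. -/
def chartMetric
    (g : Bundle.ContMDiffRiemannianMetric (𝓡 n) ∞ (EuclideanSpace ℝ (Fin n))
      (fun p : M => TangentSpace (𝓡 n) p)) (x : M) (y : EuclideanSpace ℝ (Fin n)) :
    EuclideanSpace ℝ (Fin n) →L[ℝ] EuclideanSpace ℝ (Fin n) →L[ℝ] ℝ :=
  (metricAt g ((extChartAt (𝓡 n) x).symm y)).bilinearComp
    (chartSymmDeriv x y) (chartSymmDeriv x y)

/-- The Riemann curvature tensor `R(X,Y)Z` of `g` at `x`. Tangent vectors at `x` are, by definition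
of `TangentSpace`, given by their coordinates in the preferred chart at `x`. -/
def curvature
    (g : Bundle.ContMDiffRiemannianMetric (𝓡 n) ∞ (EuclideanSpace ℝ (Fin n))
      (fun p : M => TangentSpace (𝓡 n) p)) (x : M) (X Y Z : TangentSpace (𝓡 n) x) :
    TangentSpace (𝓡 n) x :=
  localCurvature (E := EuclideanSpace ℝ (Fin n)) (chartMetric g x) (extChartAt (𝓡 n) x x) X Y Z

/-- `K` is the sectional curvature of the plane `V ⊆ T_x M`: for a basis `X, Y` of `V`,
`K = ⟨R(X,Y)Y, X⟩ / (|X|² |Y|² - ⟨X,Y⟩²)` (the quotient does not depend on the basis). -/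
def IsSectionalCurvature
    (g : Bundle.ContMDiffRiemannianMetric (𝓡 n) ∞ (EuclideanSpace ℝ (Fin n))
      (fun p : M => TangentSpace (𝓡 n) p)) (x : M)
    (V : Submodule ℝ (TangentSpace (𝓡 n) x)) (K : ℝ) : Prop :=
  ∃ X Y : TangentSpace (𝓡 n) x, LinearIndependent ℝ ![X, Y] ∧ Submodule.span ℝ {X, Y} = V ∧
    K = g.inner x (curvature g x X Y Y) X /
      (g.inner x X X * g.inner x Y Y - g.inner x X Y ^ 2)

end Intrinsic

section Product

variable {n₀ n₁ : ℕ}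
  {M₀ : Type*} [TopologicalSpace M₀] [ChartedSpace (EuclideanSpace ℝ (Fin n₀)) M₀]
  [IsManifold (𝓡 n₀) ∞ M₀]
  {M₁ : Type*} [TopologicalSpace M₁] [ChartedSpace (EuclideanSpace ℝ (Fin n₁)) M₁]
  [IsManifold (𝓡 n₁) ∞ M₁]

/-- The tangent vector to `M₀ × M₁` at `x` with components `X₀` and `X₁`. -/
def tangentPair (x : M₀ × M₁) (X₀ : TangentSpace (𝓡 n₀) x.1) (X₁ : TangentSpace (𝓡 n₁) x.2) :
    TangentSpace ((𝓡 n₀).prod (𝓡 n₁)) x :=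
  (show EuclideanSpace ℝ (Fin n₀) × EuclideanSpace ℝ (Fin n₁) from (X₀, X₁))

/-- The Riemannian product metric `π₀^* g₀ + π₁^* g₁` on `M₀ × M₁`. -/
def productMetric
    (g₀ : Bundle.ContMDiffRiemannianMetric (𝓡 n₀) ∞ (EuclideanSpace ℝ (Fin n₀))
      (fun p : M₀ => TangentSpace (𝓡 n₀) p))
    (g₁ : Bundle.ContMDiffRiemannianMetric (𝓡 n₁) ∞ (EuclideanSpace ℝ (Fin n₁))
      (fun p : M₁ => TangentSpace (𝓡 n₁) p))
    (x : M₀ × M₁) (X Y : TangentSpace ((𝓡 n₀).prod (𝓡 n₁)) x) : ℝ :=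
  g₀.inner x.1 (mfderiv ((𝓡 n₀).prod (𝓡 n₁)) (𝓡 n₀) Prod.fst x X)
      (mfderiv ((𝓡 n₀).prod (𝓡 n₁)) (𝓡 n₀) Prod.fst x Y)
    + g₁.inner x.2 (mfderiv ((𝓡 n₀).prod (𝓡 n₁)) (𝓡 n₁) Prod.snd x X)
      (mfderiv ((𝓡 n₀).prod (𝓡 n₁)) (𝓡 n₁) Prod.snd x Y)

end Product

section Extrinsic

variable {E : Type*} [NormedAddCommGroup E] [NormedSpace ℝ E]
  {H : Type*} [TopologicalSpace H]
  {M : Type*} [TopologicalSpace M] [ChartedSpace H M]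
  {F : Type*} [NormedAddCommGroup F] [InnerProductSpace ℝ F]

/-- The differential of `f : M → F` at `x`, with values in `F` itself. -/
def differential (I : ModelWithCorners ℝ E H) (f : M → F) (x : M) : TangentSpace I x →L[ℝ] F :=
  mfderiv I 𝓘(ℝ, F) f x

/-- `f : M → F` is a smooth conformal immersion for the metric `G` on `M`: there is a smooth
`φ > 0` with `⟨df X, df Y⟩ = φ² G(X, Y)`. As `G` is positive definite, `df` is then injective. -/
def IsConformalImmersion (I : ModelWithCorners ℝ E H)
    (G : ∀ x : M, TangentSpace I x → TangentSpace I x → ℝ) (f : M → F) : Prop :=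
  ContMDiff I 𝓘(ℝ, F) ∞ f ∧
    ∃ φ : M → ℝ, ContMDiff I 𝓘(ℝ, ℝ) ∞ φ ∧ (∀ x, 0 < φ x) ∧
      ∀ (x : M) (X Y : TangentSpace I x),
        inner ℝ (differential I f x X) (differential I f x Y) = φ x ^ 2 * G x X Y

/-- The normal space of `f` at `x`: the orthogonal complement of `df(T_x M)`. -/
def normalSpace (I : ModelWithCorners ℝ E H) (f : M → F) (x : M) : Submodule ℝ F :=
  (LinearMap.range (differential I f x).toLinearMap)ᗮ

/-- The second fundamental form of `f : M → F` at `x`, for a manifold without boundary: the normal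
component of the derivative of `df(Y)` in the direction `X`, where `Y` is extended with constant
coordinates in the preferred chart at `x` (another extension changes the derivative by a tangential
vector only). This is `α(X, Y) = D_X df(Y) - df(∇_X Y)` for the Levi-Civita connection of the
metric induced by `f`, since `df(∇_X Y)` is the tangential component of `D_X df(Y)`. -/
def secondFundamentalForm [FiniteDimensional ℝ F] (I : ModelWithCorners ℝ E H) [I.Boundaryless]
    (f : M → F) (x : M) (X Y : TangentSpace I x) : F :=
  (normalSpace I f x).starProjection
    (fderiv ℝ (fderiv ℝ (f ∘ (extChartAt I x).symm)) (extChartAt I x x) X Y)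

end Extrinsic

end ConformalProduct

end

/-! Lift the conformal immersion to the light cone of a Lorentzian space: with `h` the expression of
`f` in a chart, the map `F = φ⁻¹ (1, h, |h|²)` is isometric for the product metric `G`, because the
cone is null and rescaling a section of it only rescales the induced metric. The Gauss equation for
`F` (`IsInducedNear.gauss`) therefore computes the curvature of `G` itself. The normal space of `F`
is spanned by a lift `ν` of the unit normal of `h` and by the null vectors `F` and `η`. Since `⟨α,
F⟩ = -G`, the three directions contribute `B ∧ B + G ∧ S`, where `B = ⟨α, ν⟩` is `φ⁻¹` times the
second fundamental form of `h` and `S = ⟨α, η⟩` (`exists_conformal_gauss`).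

The mixed curvature components of a product vanish. If the mixed part `C` of `B` is nonzero, this
forces `C` to have rank one, say `C = β ⊗ γ` up to scale, the mixed part of `S` to be `-l C`, and on
the factors `B₀ = l G₀ + p β²`, `B₁ = l G₁ + q γ²`, `S₀ = μ G₀ - l p β²`, `S₁ = (-l² - μ) G₁ - l q
γ²`. Substituting, all sectional curvatures at the point are `l² + 2μ` on one factor and `-(l² +
2μ)` on the other (`exists_constant_opposite_curvature`), which contradicts `K₀ + K₁ ≠ 0`. -/

noncomputable section

namespace ConformalProduct

/-! ### Linear algebra of the Gauss equation on a product -/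

section Algebra

theorem exists_ne_zero_apply_eq_zero {E : Type*} [AddCommGroup E] [Module ℝ E]
    [FiniteDimensional ℝ E] (hE : 2 ≤ Module.finrank ℝ E) (σ : E →ₗ[ℝ] ℝ) :
    ∃ v, v ≠ 0 ∧ σ v = 0 := by
  have h : LinearMap.ker σ ≠ ⊥ := LinearMap.ker_ne_bot_of_finrank_lt (by
    rw [Module.finrank_self]; omega)
  obtain ⟨v, hv, hv0⟩ := Submodule.exists_mem_ne_zero_of_ne_bot h
  exact ⟨v, hv0, hv⟩

/-- Evaluating at `j = k = v` with `v ≠ 0` in the kernel of `σ` leaves `G v v * σ i = 0`. Such a `v`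
exists because the dimension is at least two. -/
theorem eq_zero_of_smul_wedge_eq_zero {E : Type*} [AddCommGroup E] [Module ℝ E]
    [FiniteDimensional ℝ E] (hE : 2 ≤ Module.finrank ℝ E) (G : E →ₗ[ℝ] E →ₗ[ℝ] ℝ)
    (hG : ∀ v, v ≠ 0 → 0 < G v v) (σ : E →ₗ[ℝ] ℝ)
    (h : ∀ i j k, G j k * σ i - G i k * σ j = 0) (i : E) : σ i = 0 := by
  obtain ⟨v, hv0, hv⟩ := exists_ne_zero_apply_eq_zero hE σ
  have h1 := h i v v
  rw [hv, mul_zero, sub_zero] at h1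
  exact (mul_eq_zero.1 h1).resolve_left (hG v hv0).ne'

/-- A symmetric form `T` with `β ∧ T(·, k) = 0` for all `k` is a multiple of `β ⊗ β`. -/
theorem exists_eq_add_mul_mul {E : Type*} [AddCommGroup E] [Module ℝ E]
    (G B : E →ₗ[ℝ] E →ₗ[ℝ] ℝ) (hGs : ∀ v w, G v w = G w v) (hBs : ∀ v w, B v w = B w v)
    (β : E →ₗ[ℝ] ℝ) {x : E} (hx : β x ≠ 0) (l : ℝ)
    (h : ∀ i j k, β i * B j k - B i k * β j + G j k * (-l * β i) - G i k * (-l * β j) = 0) :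
    ∃ p : ℝ, ∀ i j, B i j = l * G i j + p * β i * β j := by
  -- With `T = B - l G`, the hypothesis reads `β i * T j k = β j * T i k`; used in both slots it
  -- moves `i` and `j` to `x`, so `p = T x x / β x ^ 2`.
  refine ⟨(B x x - l * G x x) / β x ^ 2, fun i j => ?_⟩
  have h1 := h x i j
  have h2 := h x j x
  have h3 := hGs x j
  have h4 := hBs x j
  field_simp
  linear_combination β x * h1 + β i * h2 + β x * β i * (h4 - l * h3)

/-- The Gauss equation of a hypersurface up to a conformal factor forces a product whose mixed
second fundamental form `C` is not zero to have constant opposite curvatures. -/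
theorem exists_constant_opposite_curvature {E₀ E₁ : Type*}
    [AddCommGroup E₀] [Module ℝ E₀] [FiniteDimensional ℝ E₀]
    [AddCommGroup E₁] [Module ℝ E₁] [FiniteDimensional ℝ E₁]
    (hE₀ : 2 ≤ Module.finrank ℝ E₀) (hE₁ : 2 ≤ Module.finrank ℝ E₁)
    (G₀ B₀ S₀ : E₀ →ₗ[ℝ] E₀ →ₗ[ℝ] ℝ) (G₁ B₁ S₁ : E₁ →ₗ[ℝ] E₁ →ₗ[ℝ] ℝ)
    (C S : E₀ →ₗ[ℝ] E₁ →ₗ[ℝ] ℝ)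
    (hG₀ : ∀ v, v ≠ 0 → 0 < G₀ v v) (hG₁ : ∀ v, v ≠ 0 → 0 < G₁ v v)
    (hG₀s : ∀ v w, G₀ v w = G₀ w v) (hG₁s : ∀ v w, G₁ v w = G₁ w v)
    (hB₀s : ∀ v w, B₀ v w = B₀ w v) (hB₁s : ∀ v w, B₁ v w = B₁ w v)
    (h1 : ∀ i j a b, C i a * C j b = C i b * C j a)
    (h2 : ∀ i j a b, B₀ i j * B₁ a b - C i b * C j a + G₀ i j * S₁ a b + G₁ a b * S₀ i j = 0)
    (h3 : ∀ i j k a, C i a * B₀ j k - B₀ i k * C j a + G₀ j k * S i a - G₀ i k * S j a = 0)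
    (h4 : ∀ i a b c, C i a * B₁ b c - B₁ a c * C i b + G₁ b c * S i a - G₁ a c * S i b = 0)
    {x : E₀} {y : E₁} (hxy : C x y ≠ 0) :
    ∃ κ : ℝ,
      (∀ i j, B₀ i i * B₀ j j - B₀ i j ^ 2 + G₀ i i * S₀ j j + G₀ j j * S₀ i i
        - 2 * (G₀ i j * S₀ i j) = κ * (G₀ i i * G₀ j j - G₀ i j ^ 2)) ∧
      (∀ a b, B₁ a a * B₁ b b - B₁ a b ^ 2 + G₁ a a * S₁ b b + G₁ b b * S₁ a a
        - 2 * (G₁ a b * S₁ a b) = -κ * (G₁ a a * G₁ b b - G₁ a b ^ 2)) := by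
  -- By `h1` all 2×2 minors of `C` vanish, so `C` has rank one and its kernels are those of `C · y`
  -- and `C x ·`.
  have hC0 : ∀ i, C i y = 0 → ∀ a, C i a = 0 := fun i hi a => by
    have := h1 i x a y
    rw [hi, zero_mul] at this
    exact (mul_eq_zero.1 this).resolve_right hxy
  have hC1 : ∀ a, C x a = 0 → ∀ i, C i a = 0 := fun a ha i => by
    have := h1 i x a y
    rw [ha, mul_zero] at this
    exact (mul_eq_zero.1 this).resolve_right hxy
  -- Where `C` vanishes, `h4` and `h3` say that a form wedged with the metric is zero. Hence `S`
  -- vanishes on both kernels of `C` and is proportional to it.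
  have hS0 : ∀ i, C i y = 0 → ∀ a, S i a = 0 := fun i hi =>
    eq_zero_of_smul_wedge_eq_zero hE₁ G₁ hG₁ (S i) fun a b c => by
      have := h4 i a b c
      rw [hC0 i hi a, hC0 i hi b] at this
      linarith
  have hS1 : ∀ a, C x a = 0 → ∀ i, S i a = 0 := fun a ha =>
    eq_zero_of_smul_wedge_eq_zero hE₀ G₀ hG₀ (S.flip a) fun i j k => by
      have := h3 i j k a
      rw [hC1 a ha i, hC1 a ha j] at this
      simp only [LinearMap.flip_apply]
      linarith
  set c := C x y with hc
  obtain ⟨l, hl⟩ : ∃ l : ℝ, l = -(S x y / c) := ⟨_, rfl⟩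
  have hSC : ∀ i a, S i a = -l * C i a := fun i a => by
    have e1 := hS0 (i - (C i y / c) • x) (by simp [← hc, hxy]) a
    have e2 := hS1 (a - (C x a / c) • y) (by simp [← hc, hxy]) x
    have e3 := h1 i x a y
    simp only [map_sub, map_smul, LinearMap.sub_apply, LinearMap.smul_apply, smul_eq_mul] at e1 e2
    rw [hl, sub_eq_zero.1 e1, sub_eq_zero.1 e2]
    field_simp
    rw [← hc] at e3
    linear_combination -S x y * e3
  -- Once `S = -l C`, `h3` becomes `β ∧ (B₀ - l G₀) = 0` with `β = C · y`; likewise `h4` on the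
  -- other factor.
  obtain ⟨p, hp⟩ := exists_eq_add_mul_mul G₀ B₀ hG₀s hB₀s (C.flip y) (x := x) hxy l
    (fun i j k => by
      have := h3 i j k y
      rw [hSC i y, hSC j y] at this
      simpa using this)
  obtain ⟨q, hq⟩ := exists_eq_add_mul_mul G₁ B₁ hG₁s hB₁s (C x) (x := y) hxy l
    (fun i j k => by
      have := h4 x i j k
      rw [hSC x i, hSC x j] at this
      exact this)
  simp only [LinearMap.flip_apply] at hp
  -- At a vector in the kernel of `C`, the term in `C` drops out of `h2`, which can then be solved
  -- for `S` on the opposite factor.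
  obtain ⟨i₀, hi₀, hCi⟩ := exists_ne_zero_apply_eq_zero hE₀ (C.flip y)
  obtain ⟨a₀, ha₀, hCa⟩ := exists_ne_zero_apply_eq_zero hE₁ (C x)
  rw [LinearMap.flip_apply] at hCi
  have gi := (hG₀ i₀ hi₀).ne'
  have ga := (hG₁ a₀ ha₀).ne'
  have hS₁ : ∀ a b, S₁ a b = (-l ^ 2 - S₀ i₀ i₀ / G₀ i₀ i₀) * G₁ a b - l * q * C x a * C x b :=
    fun a b => by
      have := h2 i₀ i₀ a b
      rw [hp, hq, hCi, hC0 i₀ hCi a] at this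
      field_simp
      linear_combination this
  have hS₀ : ∀ i j, S₀ i j = (-l ^ 2 - S₁ a₀ a₀ / G₁ a₀ a₀) * G₀ i j - l * p * C i y * C j y :=
    fun i j => by
      have := h2 i j a₀ a₀
      rw [hp, hq, hCa, hC1 a₀ hCa i] at this
      field_simp
      linear_combination this
  have hμ : S₁ a₀ a₀ / G₁ a₀ a₀ = -l ^ 2 - S₀ i₀ i₀ / G₀ i₀ i₀ := by
    have := hS₁ a₀ a₀
    rw [hCa] at this
    rw [this]
    field_simp
    ring
  rw [hμ] at hS₀
  generalize S₀ i₀ i₀ / G₀ i₀ i₀ = μ at hS₀ hS₁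
  -- The terms in `p` and `q` from `B ∧ B` cancel those from `G ∧ S`. What remains is `l² + 2μ` and
  -- `l² + 2(-l² - μ)`.
  refine ⟨l ^ 2 + 2 * μ, fun i j => ?_, fun a b => ?_⟩
  · rw [hp, hp, hp, hS₀, hS₀, hS₀]
    ring
  · rw [hq, hq, hq, hS₁, hS₁, hS₁]
    ring

/-- The Gram determinant of two linearly independent vectors is positive. -/
theorem gram_det_pos {E : Type*} [AddCommGroup E] [Module ℝ E]
    (G : E →ₗ[ℝ] E →ₗ[ℝ] ℝ) (hG : ∀ v, v ≠ 0 → 0 < G v v) (hGs : ∀ v w, G v w = G w v)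
    {X Y : E} (h : LinearIndependent ℝ ![X, Y]) : 0 < G X X * G Y Y - G X Y ^ 2 := by
  rw [LinearIndependent.pair_iff] at h
  have hY : Y ≠ 0 := by
    rintro rfl
    simpa using h 0 1 (by simp)
  have hYY := hG Y hY
  -- The square norm of this vector is `G Y Y` times the Gram determinant.
  have hv : G Y Y • X + (-G X Y) • Y ≠ 0 := fun h0 => hYY.ne' (h _ _ h0).1
  have := hG _ hv
  simp only [map_add, map_smul, LinearMap.add_apply, LinearMap.smul_apply, smul_eq_mul,
    hGs Y X] at this
  refine pos_of_mul_pos_right (a := G Y Y) ?_ hYY.le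
  linarith

end Algebra

/-! ### Levi-Civita connection and Gauss equation in coordinates -/

section Gauss

open Filter Topology

variable {D E W : Type*} [NormedAddCommGroup D] [NormedSpace ℝ D]
  [NormedAddCommGroup E] [NormedSpace ℝ E] [NormedAddCommGroup W] [NormedSpace ℝ W]

/-- A family of continuous linear maps is `C^n` at a point if all its applications are. -/
theorem contDiffAt_of_clm_apply [FiniteDimensional ℝ E] {n : ℕ∞ω} {A : D → E →L[ℝ] W} {x : D}
    (h : ∀ v, ContDiffAt ℝ n (fun z => A z v) x) : ContDiffAt ℝ n A x := by
  let d := Module.finrank ℝ E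
  have hd : d = Module.finrank ℝ (Fin d → ℝ) := (Module.finrank_fin_fun ℝ).symm
  let e₁ := ContinuousLinearEquiv.ofFinrankEq hd
  let e₂ := (e₁.arrowCongr (1 : W ≃L[ℝ] W)).trans (ContinuousLinearEquiv.piRing (Fin d))
  rw [← Function.id_comp A, ← e₂.symm_comp_self]
  exact e₂.symm.contDiff.contDiffAt.comp x (contDiffAt_pi.mpr fun i => h _)

theorem hasFDerivAt_clm_apply_const {A : D → E →L[ℝ] W} {x : D}
    (h : DifferentiableAt ℝ A x) (v : E) :
    HasFDerivAt (fun z => A z v) ((fderiv ℝ A x).flip v) x := by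
  convert h.hasFDerivAt.clm_apply (hasFDerivAt_const v x) using 1
  ext; simp

theorem fderiv_bilin_apply (L : W →L[ℝ] W →L[ℝ] ℝ) {u v : D → W} {u' v' : D →L[ℝ] W} {x : D}
    (hu : HasFDerivAt u u' x) (hv : HasFDerivAt v v' x) (c : D) :
    fderiv ℝ (fun z => L (u z) (v z)) x c = L (u x) (v' c) + L (u' c) (v x) := by
  rw [(L.hasFDerivAt_of_bilinear hu hv).fderiv]
  simp

theorem isInvertible_of_nondegenerate [FiniteDimensional ℝ E] {G : E →L[ℝ] E →L[ℝ] ℝ}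
    (h : ∀ v, (∀ w, G v w = 0) → v = 0) : G.IsInvertible := by
  have hinj : Function.Injective G.toLinearMap := by
    rw [← LinearMap.ker_eq_bot, LinearMap.ker_eq_bot']
    intro v hv
    exact h v fun w => by
      have : G v = 0 := hv
      simp [this]
  have hd : Module.finrank ℝ E = Module.finrank ℝ (E →L[ℝ] ℝ) := by
    rw [(LinearMap.toContinuousLinearMap (𝕜 := ℝ) (E := E) (F' := ℝ)).symm.finrank_eq]
    exact Subspace.dual_finrank_eq.symm
  exact ⟨(LinearEquiv.ofInjectiveOfFinrankEq G.toLinearMap hinj hd).toContinuousLinearEquiv,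
    by ext; rfl⟩

theorem isInvertible_of_pos [FiniteDimensional ℝ E] {G : E →L[ℝ] E →L[ℝ] ℝ}
    (h : ∀ v, v ≠ 0 → 0 < G v v) : G.IsInvertible :=
  isInvertible_of_nondegenerate fun v hv => by
    by_contra h0
    exact (h v h0).ne' (hv v)

theorem eventually_isInvertible {D : Type*} [TopologicalSpace D] [CompleteSpace E]
    {A : D → E →L[ℝ] W} {x : D}
    (hA : ContinuousAt A x) (h : (A x).IsInvertible) : ∀ᶠ z in 𝓝 x, (A z).IsInvertible := by
  obtain ⟨e, he⟩ := h
  have := ContinuousLinearEquiv.nhds e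
  rw [he] at this
  exact hA this

theorem christoffel_spec {G : E → E →L[ℝ] E →L[ℝ] ℝ} {x : E} (h : (G x).IsInvertible) (X Y Z : E) :
    G x (christoffel G x X Y) Z = christoffelFirst G x X Y Z := by
  rw [christoffel, h.self_apply_inverse]

theorem christoffel_eq_iff {G : E → E →L[ℝ] E →L[ℝ] ℝ} {x : E} (h : (G x).IsInvertible)
    (X Y V : E) : christoffel G x X Y = V ↔ ∀ Z, G x V Z = christoffelFirst G x X Y Z := by
  constructor
  · rintro rfl Z
    exact christoffel_spec h X Y Z
  · intro hV
    apply h.injective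
    ext Z
    rw [hV, christoffel_spec h]

theorem christoffelFirst_apply (G : E → E →L[ℝ] E →L[ℝ] ℝ) (x X Y Z : E) :
    christoffelFirst G x X Y Z
      = (1 / 2) * (fderiv ℝ G x X Y Z + fderiv ℝ G x Y X Z - fderiv ℝ G x Z X Y) := by
  simp [christoffelFirst]

theorem christoffel_add_left (G : E → E →L[ℝ] E →L[ℝ] ℝ) (x X X' Y : E) :
    christoffel G x (X + X') Y = christoffel G x X Y + christoffel G x X' Y := by
  rw [christoffel, christoffel, christoffel, ← map_add]
  congr 1
  ext Z
  simp only [christoffelFirst_apply, map_add, add_apply]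
  ring

theorem christoffel_smul_left (G : E → E →L[ℝ] E →L[ℝ] ℝ) (x : E) (c : ℝ) (X Y : E) :
    christoffel G x (c • X) Y = c • christoffel G x X Y := by
  rw [christoffel, christoffel, ← map_smul]
  congr 1
  ext Z
  simp only [christoffelFirst_apply, map_smul, smul_apply, smul_eq_mul]
  ring

theorem christoffel_add_right (G : E → E →L[ℝ] E →L[ℝ] ℝ) (x X Y Y' : E) :
    christoffel G x X (Y + Y') = christoffel G x X Y + christoffel G x X Y' := by
  rw [christoffel, christoffel, christoffel, ← map_add]
  congr 1
  ext Z
  simp only [christoffelFirst_apply, map_add, add_apply]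
  ring

theorem christoffel_smul_right (G : E → E →L[ℝ] E →L[ℝ] ℝ) (x : E) (c : ℝ) (X Y : E) :
    christoffel G x X (c • Y) = c • christoffel G x X Y := by
  rw [christoffel, christoffel, ← map_smul]
  congr 1
  ext Z
  simp only [christoffelFirst_apply, map_smul, smul_apply, smul_eq_mul]
  ring

theorem christoffel_zero_left (G : E → E →L[ℝ] E →L[ℝ] ℝ) (x Y : E) :
    christoffel G x 0 Y = 0 := by
  simpa using christoffel_smul_left G x 0 0 Y

theorem christoffel_zero_right (G : E → E →L[ℝ] E →L[ℝ] ℝ) (x X : E) :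
    christoffel G x X 0 = 0 := by
  simpa using christoffel_smul_right G x 0 X 0

/-- With `localCurvature_prodMetric`, this and the next lemma make the mixed curvature components of
a product vanish. -/
theorem localCurvature_zero_left (G : E → E →L[ℝ] E →L[ℝ] ℝ) (x Y Z : E) :
    localCurvature G x 0 Y Z = 0 := by
  simp [localCurvature, christoffel_zero_left, christoffel_zero_right]

theorem localCurvature_zero_right (G : E → E →L[ℝ] E →L[ℝ] ℝ) (x X Y : E) :
    localCurvature G x X Y 0 = 0 := by
  simp [localCurvature, christoffel_zero_right]

theorem differentiableAt_christoffel [FiniteDimensional ℝ E] {G : E → E →L[ℝ] E →L[ℝ] ℝ} {x : E}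
    (hG : ContDiffAt ℝ ∞ G x) (hinv : (G x).IsInvertible) (X Y : E) :
    DifferentiableAt ℝ (fun z => christoffel G z X Y) x := by
  have := FiniteDimensional.complete ℝ E
  have hi : DifferentiableAt ℝ (fun z => (G z).inverse) x :=
    ((hinv.contDiffAt_map_inverse (n := 1)).comp x (hG.of_le (by norm_cast))).differentiableAt
      one_ne_zero
  refine hi.clm_apply ?_
  have h1 : ∀ U V T, ContDiffAt ℝ 1 (fun z => fderiv ℝ G z U V T) x := fun U V T =>
    (((hG.fderiv_right (m := 1) (by norm_cast)).clm_apply contDiffAt_const).clm_apply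
      contDiffAt_const).clm_apply contDiffAt_const
  refine ContDiffAt.differentiableAt (n := 1) (contDiffAt_of_clm_apply fun Z => ?_) one_ne_zero
  simp only [christoffelFirst_apply]
  exact contDiffAt_const.mul (((h1 X Y Z).add (h1 Y X Z)).sub (h1 Z X Y))

theorem symm_fderiv_fderiv {F : E → W} {x : E} (hF : ContDiffAt ℝ 2 F x) (X Y : E) :
    fderiv ℝ (fderiv ℝ F) x X Y = fderiv ℝ (fderiv ℝ F) x Y X :=
  hF.isSymmSndFDerivAt (by simp) X Y

/-- `G` is near `x` the metric induced by `F` from the symmetric bilinear form `L`. -/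
def IsInducedNear (L : W →L[ℝ] W →L[ℝ] ℝ) (F : E → W) (G : E → E →L[ℝ] E →L[ℝ] ℝ) (x : E) : Prop :=
  ∀ᶠ z in 𝓝 x, ∀ a b, G z a b = L (fderiv ℝ F z a) (fderiv ℝ F z b)

variable {L : W →L[ℝ] W →L[ℝ] ℝ} {F : E → W} {G : E → E →L[ℝ] E →L[ℝ] ℝ} {x : E}

theorem IsInducedNear.contDiffAt [FiniteDimensional ℝ E] (h : IsInducedNear L F G x)
    (hF : ContDiffAt ℝ ∞ F x) : ContDiffAt ℝ ∞ G x := by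
  refine contDiffAt_of_clm_apply fun a => contDiffAt_of_clm_apply fun b => ?_
  have hF' : ContDiffAt ℝ ∞ (fderiv ℝ F) x := hF.fderiv_right (by simp)
  refine ContDiffAt.congr_of_eventuallyEq ?_ (h.mono fun z hz => hz a b)
  exact (contDiffAt_const.clm_apply (hF'.clm_apply contDiffAt_const)).clm_apply
    (hF'.clm_apply contDiffAt_const)

theorem IsInducedNear.fderiv_apply (h : IsInducedNear L F G x) (hG : DifferentiableAt ℝ G x)
    (hF : ContDiffAt ℝ 2 F x) (c a b : E) :
    fderiv ℝ G x c a b = L (fderiv ℝ F x a) (fderiv ℝ (fderiv ℝ F) x c b)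
      + L (fderiv ℝ (fderiv ℝ F) x c a) (fderiv ℝ F x b) := by
  have h1 := hasFDerivAt_clm_apply_const (hasFDerivAt_clm_apply_const hG a).differentiableAt b
  rw [(hasFDerivAt_clm_apply_const hG a).fderiv] at h1
  have h2 : (fun z => G z a b) =ᶠ[𝓝 x] fun z => L (fderiv ℝ F z a) (fderiv ℝ F z b) :=
    h.mono fun z hz => hz a b
  have hd : DifferentiableAt ℝ (fderiv ℝ F) x :=
    (hF.fderiv_right (m := 1) (by norm_num)).differentiableAt one_ne_zero
  have h3 := fderiv_bilin_apply L (hasFDerivAt_clm_apply_const hd a)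
    (hasFDerivAt_clm_apply_const hd b) c
  rw [← h2.fderiv_eq, h1.fderiv] at h3
  exact h3

/-- Each derivative of the metric splits into two terms by the product rule; symmetry of the second
derivative cancels all but one pair in the Koszul formula. -/
theorem IsInducedNear.christoffelFirst_eq (hL : ∀ v w, L v w = L w v) (h : IsInducedNear L F G x)
    (hG : DifferentiableAt ℝ G x) (hF : ContDiffAt ℝ 2 F x) (X Y Z : E) :
    christoffelFirst G x X Y Z = L (fderiv ℝ (fderiv ℝ F) x X Y) (fderiv ℝ F x Z) := by
  rw [christoffelFirst_apply, h.fderiv_apply hG hF, h.fderiv_apply hG hF, h.fderiv_apply hG hF,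
    symm_fderiv_fderiv hF Y X, symm_fderiv_fderiv hF Z X, symm_fderiv_fderiv hF Z Y,
    hL (fderiv ℝ F x Y), hL (fderiv ℝ F x X)]
  ring

/-- The normal component `∂_X ∂_Y F - dF(∇_X Y)` of the second derivative of `F`. -/
def normalHessian (F : E → W) (G : E → E →L[ℝ] E →L[ℝ] ℝ) (x X Y : E) : W :=
  fderiv ℝ (fderiv ℝ F) x X Y - fderiv ℝ F x (christoffel G x X Y)

theorem IsInducedNear.eventually (h : IsInducedNear L F G x) :
    ∀ᶠ z in 𝓝 x, IsInducedNear L F G z :=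
  eventually_eventually_nhds.2 h

theorem IsInducedNear.normalHessian_orthogonal (hL : ∀ v w, L v w = L w v)
    (h : IsInducedNear L F G x) (hG : DifferentiableAt ℝ G x) (hinv : (G x).IsInvertible)
    (hF : ContDiffAt ℝ 2 F x) (X Y Z : E) : L (normalHessian F G x X Y) (fderiv ℝ F x Z) = 0 := by
  rw [normalHessian, map_sub, sub_apply, ← h.christoffelFirst_eq hL hG hF,
    ← h.self_of_nhds, christoffel_spec hinv, sub_self]

/-- The Gauss equation for a map into a vector space with a symmetric bilinear form. -/
theorem IsInducedNear.gauss [FiniteDimensional ℝ E] (hL : ∀ v w, L v w = L w v)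
    (h : IsInducedNear L F G x) (hinv : (G x).IsInvertible) (hF : ContDiffAt ℝ ∞ F x)
    (X Y Z V : E) :
    G x (localCurvature G x X Y Z) V
      = L (normalHessian F G x Y Z) (normalHessian F G x X V)
        - L (normalHessian F G x X Z) (normalHessian F G x Y V) := by
  have := FiniteDimensional.complete ℝ E
  have hGs := h.contDiffAt hF
  have hG2 : ContDiffAt ℝ 2 G x := hGs.of_le (by norm_cast)
  have hF2 : ContDiffAt ℝ 2 F x := hF.of_le (by norm_cast)
  have hGd : DifferentiableAt ℝ G x := hG2.differentiableAt two_ne_zero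
  have hF' : ContDiffAt ℝ 2 (fderiv ℝ F) x := hF.fderiv_right (by norm_cast)
  have hF'd : DifferentiableAt ℝ (fderiv ℝ F) x := hF'.differentiableAt two_ne_zero
  have hF''d : DifferentiableAt ℝ (fderiv ℝ (fderiv ℝ F)) x :=
    (hF'.fderiv_right (m := 1) (by norm_num)).differentiableAt one_ne_zero
  -- This must hold on a neighbourhood, since `key` is its derivative at `x`.
  have hnear : ∀ᶠ z in 𝓝 x, ∀ A B C, G z (christoffel G z A B) C
      = L (fderiv ℝ (fderiv ℝ F) z A B) (fderiv ℝ F z C) := by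
    filter_upwards [h.eventually, hG2.eventually (by simp), hF2.eventually (by simp),
      eventually_isInvertible hGs.continuousAt hinv] with z h1 h2 h3 h4 A B C
    rw [christoffel_spec h4, h1.christoffelFirst_eq hL (h2.differentiableAt two_ne_zero) h3]
  have key : ∀ A B C, G x (fderiv ℝ (fun z => christoffel G z B C) x A) V
      + G x (christoffel G x A (christoffel G x B C)) V
      = L (fderiv ℝ (fderiv ℝ (fderiv ℝ F)) x A B C) (fderiv ℝ F x V)
        + L (normalHessian F G x B C) (fderiv ℝ (fderiv ℝ F) x A V) := by
    intro A B C
    have hΓ := (differentiableAt_christoffel hGs hinv B C).hasFDerivAt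
    have e1 : HasFDerivAt (fun z => G z (christoffel G z B C)) _ x := hGd.hasFDerivAt.clm_apply hΓ
    have e2 := hasFDerivAt_clm_apply_const e1.differentiableAt V
    rw [e1.fderiv] at e2
    have hBC := hasFDerivAt_clm_apply_const hF''d B
    have hBC' := hasFDerivAt_clm_apply_const hBC.differentiableAt C
    rw [hBC.fderiv] at hBC'
    have e3 := fderiv_bilin_apply L hBC' (hasFDerivAt_clm_apply_const hF'd V) A
    rw [← Filter.EventuallyEq.fderiv_eq (hnear.mono fun z hz => hz B C V), e2.fderiv] at e3
    simp only [ContinuousLinearMap.flip_apply, add_apply,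
      ContinuousLinearMap.comp_apply] at e3
    rw [h.fderiv_apply hGd hF2] at e3
    rw [normalHessian, map_sub, sub_apply]
    have e4 := hnear.self_of_nhds A (christoffel G x B C) V
    linarith
  have kX := key X Y Z
  have kY := key Y X Z
  -- The third derivatives cancel on antisymmetrizing `key` in `X` and `Y`, leaving products of
  -- second derivatives.
  have hsym : fderiv ℝ (fderiv ℝ (fderiv ℝ F)) x X Y = fderiv ℝ (fderiv ℝ (fderiv ℝ F)) x Y X :=
    symm_fderiv_fderiv hF' X Y
  have split : ∀ A B C, L (normalHessian F G x B C) (normalHessian F G x A V)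
      = L (normalHessian F G x B C) (fderiv ℝ (fderiv ℝ F) x A V) := by
    intro A B C
    rw [normalHessian.eq_def F G x A V, map_sub, h.normalHessian_orthogonal hL hGd hinv hF2,
      sub_zero]
  rw [split, split, localCurvature]
  simp only [map_sub, map_add, sub_apply, add_apply]
  rw [hsym] at kX
  linarith

end Gauss

/-! ### Lifting maps to the light cone -/

section Cone

open Filter Topology

variable {V : Type*} [NormedAddCommGroup V] [InnerProductSpace ℝ V]

/-- The Lorentzian form `⟨v, v'⟩ - ½ (a b' + a' b)` on `ℝ × V × ℝ`. -/
def lorentzForm (V : Type*) [NormedAddCommGroup V] [InnerProductSpace ℝ V] :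
    (ℝ × V × ℝ) →L[ℝ] (ℝ × V × ℝ) →L[ℝ] ℝ :=
  (isBoundedBilinearMap_inner (𝕜 := ℝ) (E := V)).toContinuousLinearMap.bilinearComp
      (.fst ℝ V ℝ ∘L .snd ℝ ℝ (V × ℝ)) (.fst ℝ V ℝ ∘L .snd ℝ ℝ (V × ℝ))
    - (1 / 2 : ℝ) •
      ((ContinuousLinearMap.mul ℝ ℝ).bilinearComp (.fst ℝ ℝ (V × ℝ))
          (.snd ℝ V ℝ ∘L .snd ℝ ℝ (V × ℝ))
        + (ContinuousLinearMap.mul ℝ ℝ).bilinearComp (.snd ℝ V ℝ ∘L .snd ℝ ℝ (V × ℝ))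
          (.fst ℝ ℝ (V × ℝ)))

theorem lorentzForm_apply (v w : ℝ × V × ℝ) :
    lorentzForm V v w = inner ℝ v.2.1 w.2.1 - (1 / 2) * (v.1 * w.2.2 + v.2.2 * w.1) := by
  simp [lorentzForm]
  ring

theorem lorentzForm_comm (v w : ℝ × V × ℝ) : lorentzForm V v w = lorentzForm V w v := by
  rw [lorentzForm_apply, lorentzForm_apply, real_inner_comm]
  ring

/-- The section `p ↦ (1, p, |p|²)` of the light cone. -/
def coneLift (p : V) : ℝ × V × ℝ := (1, p, inner ℝ p p)

/-- The differential of `coneLift`. -/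
def coneLiftDeriv (p u : V) : ℝ × V × ℝ := (0, u, 2 * inner ℝ p u)

theorem lorentzForm_coneLift_self (p : V) : lorentzForm V (coneLift p) (coneLift p) = 0 := by
  simp only [lorentzForm_apply, coneLift]
  ring

theorem lorentzForm_coneLiftDeriv (p q u v : V) :
    lorentzForm V (coneLiftDeriv p u) (coneLiftDeriv q v) = inner ℝ u v := by
  simp [lorentzForm_apply, coneLiftDeriv]

/-- The two base points are independent so that a lifted normal can stay fixed at `q` while `p`
moves. -/
theorem lorentzForm_coneLift_coneLiftDeriv (p q u : V) :
    lorentzForm V (coneLift p) (coneLiftDeriv q u) = inner ℝ (p - q) u := by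
  simp only [lorentzForm_apply, coneLift, coneLiftDeriv, inner_sub_left]
  ring

/-- A vector orthogonal to `coneLift p` and to lifts of enough vectors is a multiple of
`coneLift p`. -/
theorem eq_smul_coneLift {p : V} {ξ : ℝ × V × ℝ} {s : Set V}
    (hs : ∀ v, (∀ u ∈ s, inner ℝ v u = 0) → v = 0)
    (h0 : lorentzForm V ξ (coneLift p) = 0)
    (h1 : ∀ u ∈ s, lorentzForm V ξ (coneLiftDeriv p u) = 0) : ξ = ξ.1 • coneLift p := by
  -- Pairing `ξ` with `coneLiftDeriv p u` gives exactly `⟨ξ.2.1 - ξ.1 • p, u⟩`; the last coordinate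
  -- of `ξ` then follows from `h0`.
  have hw : ξ.2.1 - ξ.1 • p = 0 := hs _ fun u hu => by
    have := h1 u hu
    simp only [lorentzForm_apply, coneLiftDeriv] at this
    rw [inner_sub_left, real_inner_smul_left]
    linarith
  rw [sub_eq_zero] at hw
  simp only [lorentzForm_apply, coneLift, hw, real_inner_smul_left] at h0
  refine Prod.ext ?_ (Prod.ext ?_ ?_)
  · simp [coneLift]
  · simpa [coneLift] using hw
  · simp only [coneLift, Prod.smul_snd, smul_eq_mul]
    linarith

variable {E : Type*} [NormedAddCommGroup E] [NormedSpace ℝ E]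

theorem hasFDerivAt_coneLift_comp {h : E → V} {x : E} (hh : DifferentiableAt ℝ h x) :
    ∃ D : E →L[ℝ] ℝ × V × ℝ, HasFDerivAt (fun z => coneLift (h z)) D x ∧
      ∀ a, D a = coneLiftDeriv (h x) (fderiv ℝ h x a) := by
  have h1 := hh.hasFDerivAt
  refine ⟨_, (hasFDerivAt_const (1 : ℝ) x).prodMk (h1.prodMk (h1.inner ℝ h1)), fun a => ?_⟩
  simp [coneLiftDeriv, fderivInnerCLM_apply, real_inner_comm, two_mul]

theorem contDiffAt_coneLift_comp {h : E → V} {x : E} {n : ℕ∞ω} (hh : ContDiffAt ℝ n h x) :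
    ContDiffAt ℝ n (fun z => coneLift (h z)) x :=
  contDiffAt_const.prodMk (hh.prodMk (hh.inner ℝ hh))

theorem fderiv_smul_coneLift {h : E → V} {ψ : E → ℝ} {x : E} (hh : DifferentiableAt ℝ h x)
    (hψ : DifferentiableAt ℝ ψ x) (a : E) :
    fderiv ℝ (fun z => ψ z • coneLift (h z)) x a
      = ψ x • coneLiftDeriv (h x) (fderiv ℝ h x a) + fderiv ℝ ψ x a • coneLift (h x) := by
  obtain ⟨D, hD, hDa⟩ := hasFDerivAt_coneLift_comp hh
  rw [(hψ.hasFDerivAt.fun_smul hD).fderiv]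
  simp [hDa]

/-- The derivative of `ψ` only contributes multiples of `coneLift (h x)`, which is null and
orthogonal to the derivative of the lift. The choice `ψ = φ⁻¹` thus removes the conformal factor. -/
theorem lorentzForm_fderiv_smul_coneLift {h : E → V} {ψ : E → ℝ} {x : E}
    (hh : DifferentiableAt ℝ h x) (hψ : DifferentiableAt ℝ ψ x) (a b : E) :
    lorentzForm V (fderiv ℝ (fun z => ψ z • coneLift (h z)) x a)
        (fderiv ℝ (fun z => ψ z • coneLift (h z)) x b)
      = ψ x ^ 2 * inner ℝ (fderiv ℝ h x a) (fderiv ℝ h x b) := by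
  rw [fderiv_smul_coneLift hh hψ, fderiv_smul_coneLift hh hψ]
  simp only [map_add, map_smul, add_apply, smul_apply, smul_eq_mul, lorentzForm_coneLiftDeriv,
    lorentzForm_coneLift_self, lorentzForm_coneLift_coneLiftDeriv,
    lorentzForm_comm (coneLiftDeriv _ _) (coneLift _), sub_self, inner_zero_left]
  ring

/-- On the cone the position vector is itself a normal field. -/
theorem lorentzForm_fderiv_smul_coneLift_self {h : E → V} {ψ : E → ℝ} {x : E}
    (hh : DifferentiableAt ℝ h x) (hψ : DifferentiableAt ℝ ψ x) (a : E) :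
    lorentzForm V (fderiv ℝ (fun z => ψ z • coneLift (h z)) x a) (ψ x • coneLift (h x)) = 0 := by
  rw [fderiv_smul_coneLift hh hψ]
  simp [lorentzForm_coneLift_self, lorentzForm_coneLift_coneLiftDeriv,
    lorentzForm_comm (coneLiftDeriv _ _) (coneLift _)]

theorem lorentzForm_fderiv_smul_coneLift_lift {h : E → V} {ψ : E → ℝ} {x : E}
    (hh : DifferentiableAt ℝ h x) (hψ : DifferentiableAt ℝ ψ x) (p N : V) (a : E) :
    lorentzForm V (fderiv ℝ (fun z => ψ z • coneLift (h z)) x a) (coneLiftDeriv p N)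
      = ψ x * inner ℝ (fderiv ℝ h x a) N + fderiv ℝ ψ x a * inner ℝ (h x - p) N := by
  rw [fderiv_smul_coneLift hh hψ]
  simp [lorentzForm_coneLiftDeriv, lorentzForm_coneLift_coneLiftDeriv]

/-- The second derivative of `ψ • coneLift ∘ h` in the direction of the lift of a normal vector. -/
theorem lorentzForm_hessian_smul_coneLift {h : E → V} {ψ : E → ℝ} {x : E}
    (hh : ContDiffAt ℝ 2 h x) (hψ : ContDiffAt ℝ 2 ψ x) {N : V}
    (hN : ∀ a, inner ℝ (fderiv ℝ h x a) N = 0) (a b : E) :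
    lorentzForm V (fderiv ℝ (fderiv ℝ (fun z => ψ z • coneLift (h z))) x a b)
        (coneLiftDeriv (h x) N)
      = ψ x * inner ℝ (fderiv ℝ (fderiv ℝ h) x a b) N := by
  have hF : ContDiffAt ℝ 2 (fun z => ψ z • coneLift (h z)) x :=
    hψ.smul (contDiffAt_coneLift_comp hh)
  have hF' := (hF.fderiv_right (m := 1) (by norm_num)).differentiableAt one_ne_zero
  have hh' := (hh.fderiv_right (m := 1) (by norm_num)).differentiableAt one_ne_zero
  have hψ' := (hψ.fderiv_right (m := 1) (by norm_num)).differentiableAt one_ne_zero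
  have hhd := hh.differentiableAt two_ne_zero
  have hψd := hψ.differentiableAt two_ne_zero
  -- The lifted normal is frozen at `x`. On differentiating, every term with a derivative of `ψ`
  -- carries a factor `h x - h x` or `⟨dh, N⟩` and vanishes at `x`.
  have near : (fun z => lorentzForm V (fderiv ℝ (fun z => ψ z • coneLift (h z)) z b)
        (coneLiftDeriv (h x) N)) =ᶠ[𝓝 x]
      fun z => ψ z * inner ℝ (fderiv ℝ h z b) N + fderiv ℝ ψ z b * inner ℝ (h z - h x) N := by
    filter_upwards [hh.eventually (by simp), hψ.eventually (by simp)] with z h1 h2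
    exact lorentzForm_fderiv_smul_coneLift_lift (h1.differentiableAt two_ne_zero)
      (h2.differentiableAt two_ne_zero) _ _ _
  have e1 := fderiv_bilin_apply (lorentzForm V) (hasFDerivAt_clm_apply_const hF' b)
    (hasFDerivAt_const (coneLiftDeriv (h x) N) x) a
  have d1 := hψd.hasFDerivAt.fun_mul
    ((hasFDerivAt_clm_apply_const hh' b).inner ℝ (hasFDerivAt_const N x))
  have d2 := (hasFDerivAt_clm_apply_const hψ' b).fun_mul
    ((hhd.hasFDerivAt.fun_sub (hasFDerivAt_const (h x) x)).inner ℝ (hasFDerivAt_const N x))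
  rw [near.fderiv_eq, (d1.fun_add d2).fderiv] at e1
  simp [fderivInnerCLM_apply, hN] at e1
  linarith

end Cone

/-! ### Curvature of a conformal hypersurface -/

section Hypersurface

open Filter Topology

variable {V : Type*} [NormedAddCommGroup V] [InnerProductSpace ℝ V]
  {E : Type*} [NormedAddCommGroup E] [NormedSpace ℝ E]

/-- The Gauss equation of a conformal hypersurface: up to a conformally flat term `G ∧ S`, the
curvature tensor of `G` is the square of the second fundamental form. -/
theorem exists_conformal_gauss [FiniteDimensional ℝ E] [Nontrivial E] {h : E → V} {φ : E → ℝ}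
    {G : E → E →L[ℝ] E →L[ℝ] ℝ} {x : E} (hh : ContDiffAt ℝ ∞ h x) (hφ : ContDiffAt ℝ ∞ φ x)
    (hφ0 : 0 < φ x)
    (hG : ∀ᶠ z in 𝓝 x, ∀ a b, inner ℝ (fderiv ℝ h z a) (fderiv ℝ h z b) = φ z ^ 2 * G z a b)
    (hpos : ∀ v, v ≠ 0 → 0 < G x v v) {N : V} (hN1 : inner ℝ N N = (1 : ℝ))
    (hN : ∀ a, inner ℝ (fderiv ℝ h x a) N = 0)
    (hspan : ∀ v, (∀ a, inner ℝ v (fderiv ℝ h x a) = 0) → inner ℝ v N = 0 → v = 0) :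
    ContDiffAt ℝ ∞ G x ∧
    ∃ B S : E →ₗ[ℝ] E →ₗ[ℝ] ℝ,
      (∀ a b, B a b = (φ x)⁻¹ * inner ℝ (fderiv ℝ (fderiv ℝ h) x a b) N) ∧
      (∀ a b, B a b = B b a) ∧ (∀ a b, S a b = S b a) ∧
      ∀ X Y Z U, G x (localCurvature G x X Y Z) U
        = (B Y Z * B X U + G x Y Z * S X U + S Y Z * G x X U)
          - (B X Z * B Y U + G x X Z * S Y U + S X Z * G x Y U) := by
  have hh2 : ContDiffAt ℝ 2 h x := hh.of_le (by norm_cast)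
  have hψ : ContDiffAt ℝ ∞ (fun z => (φ z)⁻¹) x := hφ.inv hφ0.ne'
  have hψ2 : ContDiffAt ℝ 2 (fun z => (φ z)⁻¹) x := hψ.of_le (by norm_cast)
  obtain ⟨F, hFdef⟩ : ∃ F : E → ℝ × V × ℝ, F = fun z => (φ z)⁻¹ • coneLift (h z) := ⟨_, rfl⟩
  have hF : ContDiffAt ℝ ∞ F x := by
    rw [hFdef]; exact hψ.smul (contDiffAt_coneLift_comp hh)
  have hF2 : ContDiffAt ℝ 2 F x := hF.of_le (by norm_cast)
  have hFd := hF2.differentiableAt two_ne_zero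
  have hF'd := (hF2.fderiv_right (m := 1) (by norm_num)).differentiableAt one_ne_zero
  have hd : ∀ᶠ z in 𝓝 x, DifferentiableAt ℝ h z ∧ DifferentiableAt ℝ (fun z => (φ z)⁻¹) z := by
    filter_upwards [hh2.eventually (by simp), hψ2.eventually (by simp)] with z h1 h2
    exact ⟨h1.differentiableAt two_ne_zero, h2.differentiableAt two_ne_zero⟩
  have hφz : ∀ᶠ z in 𝓝 x, φ z ≠ 0 := hφ.continuousAt.eventually_ne hφ0.ne'
  set L := lorentzForm V with hLdef
  have hL : ∀ v w, L v w = L w v := lorentzForm_comm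
  have hind : IsInducedNear L F G x := by
    filter_upwards [hd, hφz, hG] with z h1 h2 h3 a b
    rw [hFdef, hLdef, lorentzForm_fderiv_smul_coneLift h1.1 h1.2, h3]
    field_simp
  have hGs := hind.contDiffAt hF
  have hGd : DifferentiableAt ℝ G x :=
    (hGs.of_le (m := 2) (by norm_cast)).differentiableAt two_ne_zero
  have hinv := isInvertible_of_pos hpos
  refine ⟨hGs, ?_⟩
  set ν := coneLiftDeriv (h x) N with hν
  set H := coneLift (h x) with hH
  have hFx : F x = (φ x)⁻¹ • H := by rw [hFdef]
  have hF'F : ∀ a, L (fderiv ℝ F x a) (F x) = 0 := fun a => by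
    rw [hFdef]
    exact lorentzForm_fderiv_smul_coneLift_self hd.self_of_nhds.1 hd.self_of_nhds.2 a
  have hF'ν : ∀ a, L (fderiv ℝ F x a) ν = 0 := fun a => by
    rw [hFdef, hLdef, hν, lorentzForm_fderiv_smul_coneLift_lift hd.self_of_nhds.1
      hd.self_of_nhds.2, hN]
    simp
  -- Differentiate `⟨dF, F⟩ = 0`.
  have hF''F : ∀ a b, L (fderiv ℝ (fderiv ℝ F) x a b) (F x) = -G x a b := fun a b => by
    have e1 := fderiv_bilin_apply L (hasFDerivAt_clm_apply_const hF'd b) hFd.hasFDerivAt a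
    have near : (fun z => L (fderiv ℝ F z b) (F z)) =ᶠ[𝓝 x] fun _ => 0 := by
      filter_upwards [hd] with z h1
      rw [hFdef]
      exact lorentzForm_fderiv_smul_coneLift_self h1.1 h1.2 b
    rw [near.fderiv_eq, hL (fderiv ℝ F x b), ← hind.self_of_nhds] at e1
    simp at e1
    linarith
  have hF''ν : ∀ a b, L (fderiv ℝ (fderiv ℝ F) x a b) ν
      = (φ x)⁻¹ * inner ℝ (fderiv ℝ (fderiv ℝ h) x a b) N := fun a b => by
    rw [hFdef]
    exact lorentzForm_hessian_smul_coneLift hh2 hψ2 hN a b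
  have hΓs : ∀ a b, christoffel G x a b = christoffel G x b a := fun a b => by
    rw [christoffel_eq_iff hinv]
    intro Z
    rw [christoffel_spec hinv, hind.christoffelFirst_eq hL hGd hF2,
      hind.christoffelFirst_eq hL hGd hF2, symm_fderiv_fderiv hF2]
  obtain ⟨α, hα⟩ : ∃ α : E →ₗ[ℝ] E →ₗ[ℝ] ℝ × V × ℝ, ∀ a b, α a b = normalHessian F G x a b := by
    refine ⟨LinearMap.mk₂ ℝ (normalHessian F G x) ?_ ?_ ?_ ?_, fun a b => rfl⟩
    · intro a a' b
      simp only [normalHessian, christoffel_add_left, map_add, add_apply]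
      abel
    · intro c a b
      simp only [normalHessian, christoffel_smul_left, map_smul, smul_apply, smul_sub]
    · intro a b b'
      simp only [normalHessian, christoffel_add_right, map_add]
      abel
    · intro c a b
      simp only [normalHessian, christoffel_smul_right, map_smul, smul_sub]
  have hαs : ∀ a b, α a b = α b a := fun a b => by
    rw [hα, hα, normalHessian, normalHessian, symm_fderiv_fderiv hF2, hΓs]
  have hαF' : ∀ a b c, L (α a b) (fderiv ℝ F x c) = 0 := fun a b c => by
    rw [hα]
    exact hind.normalHessian_orthogonal hL hGd hinv hF2 a b c
  have hαF : ∀ a b, L (α a b) (F x) = -G x a b := fun a b => by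
    rw [hα, normalHessian, map_sub, sub_apply, hF''F, hF'F, sub_zero]
  have hαν : ∀ a b, L (α a b) ν = (φ x)⁻¹ * inner ℝ (fderiv ℝ (fderiv ℝ h) x a b) N :=
    fun a b => by rw [hα, normalHessian, map_sub, sub_apply, hF''ν, hF'ν, sub_zero]
  have hFF : L (F x) (F x) = 0 := by
    rw [hFx]
    simp only [map_smul, smul_apply, hLdef, hH, lorentzForm_coneLift_self, smul_zero]
  have hνF : L ν (F x) = 0 := by
    rw [hFx, hL]
    simp [hLdef, hH, hν, lorentzForm_coneLift_coneLiftDeriv]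
  have hνν : L ν ν = 1 := by rw [hLdef, hν, lorentzForm_coneLiftDeriv, hN1]
  -- a null vector `η` normal to `F` and `ν` with `L η F = -1`
  obtain ⟨η, hηF, hηF', hην, hηη⟩ : ∃ η, L η (F x) = -1 ∧ (∀ c, L η (fderiv ℝ F x c) = 0) ∧
      L η ν = 0 ∧ L η η = 0 := by
    obtain ⟨a, ha⟩ := exists_ne (0 : E)
    have hg := (hpos a ha).ne'
    -- A value of `α` supplies the direction transverse to `F`, since `⟨α a a, F⟩ = -G a a ≠ 0`.
    -- Adding `½ ⟨η, η⟩ F` below makes it null without changing its other products.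
    obtain ⟨η, hη⟩ : ∃ η, η = (G x a a)⁻¹ • (α a a - L (α a a) ν • ν) := ⟨_, rfl⟩
    have e1 : L η (F x) = -1 := by
      simp only [hη, map_smul, map_sub, sub_apply, smul_apply, smul_eq_mul, hαF, hνF]
      field_simp
      ring
    have e2 : ∀ c, L η (fderiv ℝ F x c) = 0 := fun c => by
      simp only [hη, map_smul, map_sub, sub_apply, smul_apply, smul_eq_mul, hαF',
        hL ν (fderiv ℝ F x c), hF'ν]
      ring
    have e3 : L η ν = 0 := by
      simp only [hη, map_smul, map_sub, sub_apply, smul_apply, smul_eq_mul, hνν]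
      ring
    refine ⟨η + (1 / 2 * L η η) • F x, ?_, fun c => ?_, ?_, ?_⟩
    · simp [e1, hFF]
    · simp [e2, hL (F x) (fderiv ℝ F x c), hF'F]
    · simp [e3, hL (F x) ν, hνF]
    · simp only [map_add, map_smul, add_apply, smul_apply, smul_eq_mul, e1, hL (F x) η, hFF]
      ring
  -- The remainder `ξ` is orthogonal to `F`, `ν` and the image of `dF`, hence a multiple of `F` by
  -- `eq_smul_coneLift`.
  have hdec : ∀ a b, ∃ t : ℝ, α a b = L (α a b) ν • ν + G x a b • η + t • F x := by
    intro a b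
    obtain ⟨ξ, hξ⟩ : ∃ ξ, ξ = α a b - L (α a b) ν • ν - G x a b • η := ⟨_, rfl⟩
    have hξF : L ξ (F x) = 0 := by
      simp only [hξ, map_smul, map_sub, sub_apply, smul_apply, smul_eq_mul, hαF, hνF, hηF]
      ring
    have hξH : L ξ H = 0 := by
      rw [hFx, map_smul, smul_eq_mul] at hξF
      exact (mul_eq_zero.1 hξF).resolve_left (inv_ne_zero hφ0.ne')
    have hξF' : ∀ c, L ξ (fderiv ℝ F x c) = 0 := fun c => by
      simp only [hξ, map_smul, map_sub, sub_apply, smul_apply, smul_eq_mul, hαF', hηF',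
        hL ν (fderiv ℝ F x c), hF'ν]
      ring
    have hξν : L ξ ν = 0 := by
      simp only [hξ, map_smul, map_sub, sub_apply, smul_apply, smul_eq_mul, hνν, hην]
      ring
    have := eq_smul_coneLift (p := h x) (ξ := ξ)
      (s := insert N (Set.range fun a => fderiv ℝ h x a)) ?_ hξH ?_
    · refine ⟨ξ.1 * φ x, ?_⟩
      rw [hFx, smul_smul, mul_assoc, mul_inv_cancel₀ hφ0.ne', mul_one, ← this, hξ]
      abel
    · intro v hv
      exact hspan v (fun a => hv _ (Set.mem_insert_of_mem _ ⟨a, rfl⟩)) (hv _ (Set.mem_insert _ _))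
    · rintro u (rfl | ⟨c, rfl⟩)
      · exact hξν
      · have := hξF' c
        rw [hFdef, fderiv_smul_coneLift hd.self_of_nhds.1 hd.self_of_nhds.2, map_add, map_smul,
          map_smul, hξH, smul_zero, add_zero, smul_eq_mul] at this
        exact (mul_eq_zero.1 this).resolve_left (inv_ne_zero hφ0.ne')
  have hαα : ∀ a b c d, L (α a b) (α c d)
      = L (α a b) ν * L (α c d) ν + G x a b * L (α c d) η + L (α a b) η * G x c d := by
    intro a b c d
    have hcd : L (α c d) (F x) = -G x c d := hαF c d
    obtain ⟨t, ht⟩ := hdec a b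
    have e1 : L (α a b) η = -t := by
      rw [ht]
      simp only [map_add, map_smul, add_apply, smul_apply, smul_eq_mul, hηη, hL ν η, hην,
        hL (F x) η, hηF]
      ring
    rw [e1]
    conv_lhs => rw [ht]
    simp only [map_add, map_smul, add_apply, smul_apply, smul_eq_mul, hL ν (α c d),
      hL η (α c d), hL (F x) (α c d), hcd]
    ring
  refine ⟨α.compr₂ (L.flip ν).toLinearMap, α.compr₂ (L.flip η).toLinearMap, fun a b => ?_,
    fun a b => ?_, fun a b => ?_, fun X Y Z U => ?_⟩
  · simpa using hαν a b
  · simp [hαs a b]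
  · simp [hαs a b]
  · rw [hind.gauss hL hinv hF, ← hα, ← hα, ← hα, ← hα, hαα, hαα]
    simp

end Hypersurface

/-! ### Product metrics on vector spaces -/

section LocalProduct

open Filter Topology

variable {E₀ E₁ : Type*} [NormedAddCommGroup E₀] [NormedSpace ℝ E₀]
  [NormedAddCommGroup E₁] [NormedSpace ℝ E₁]

/-- The product of two metrics on vector spaces. -/
def prodMetric (G₀ : E₀ → E₀ →L[ℝ] E₀ →L[ℝ] ℝ) (G₁ : E₁ → E₁ →L[ℝ] E₁ →L[ℝ] ℝ) (z : E₀ × E₁) :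
    (E₀ × E₁) →L[ℝ] (E₀ × E₁) →L[ℝ] ℝ :=
  (G₀ z.1).bilinearComp (.fst ℝ E₀ E₁) (.fst ℝ E₀ E₁)
    + (G₁ z.2).bilinearComp (.snd ℝ E₀ E₁) (.snd ℝ E₀ E₁)

variable {G₀ : E₀ → E₀ →L[ℝ] E₀ →L[ℝ] ℝ} {G₁ : E₁ → E₁ →L[ℝ] E₁ →L[ℝ] ℝ} {z : E₀ × E₁}

theorem prodMetric_apply (a b : E₀ × E₁) :
    prodMetric G₀ G₁ z a b = G₀ z.1 a.1 b.1 + G₁ z.2 a.2 b.2 := by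
  simp [prodMetric]

/-- Restrict to a slice. The factor metrics get their smoothness this way, from that of the product
metric, which is induced by the smooth lift to the cone. -/
theorem contDiffAt_fst_of_prodMetric [FiniteDimensional ℝ E₀] {n : ℕ∞ω}
    (h : ContDiffAt ℝ n (prodMetric G₀ G₁) z) :
    ContDiffAt ℝ n G₀ z.1 := by
  refine contDiffAt_of_clm_apply fun a => contDiffAt_of_clm_apply fun b => ?_
  have h1 : ContDiffAt ℝ n (fun w : E₀ => prodMetric G₀ G₁ (w, z.2)) z.1 :=
    ContDiffAt.comp (g := prodMetric G₀ G₁) (f := fun w : E₀ => (w, z.2)) z.1 h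
      (contDiffAt_id.prodMk contDiffAt_const)
  have h2 := (h1.clm_apply (contDiffAt_const (c := (a, (0 : E₁))))).clm_apply
    (contDiffAt_const (c := (b, (0 : E₁))))
  simpa [prodMetric_apply] using h2

theorem contDiffAt_snd_of_prodMetric [FiniteDimensional ℝ E₁] {n : ℕ∞ω}
    (h : ContDiffAt ℝ n (prodMetric G₀ G₁) z) :
    ContDiffAt ℝ n G₁ z.2 := by
  refine contDiffAt_of_clm_apply fun a => contDiffAt_of_clm_apply fun b => ?_
  have h1 : ContDiffAt ℝ n (fun w : E₁ => prodMetric G₀ G₁ (z.1, w)) z.2 :=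
    ContDiffAt.comp (g := prodMetric G₀ G₁) (f := fun w : E₁ => (z.1, w)) z.2 h
      (contDiffAt_const.prodMk contDiffAt_id)
  have h2 := (h1.clm_apply (contDiffAt_const (c := ((0 : E₀), a)))).clm_apply
    (contDiffAt_const (c := ((0 : E₀), b)))
  simpa [prodMetric_apply] using h2

variable [FiniteDimensional ℝ E₀] [FiniteDimensional ℝ E₁]

theorem fderiv_prodMetric_apply (d₀ : ContDiffAt ℝ 1 G₀ z.1) (d₁ : ContDiffAt ℝ 1 G₁ z.2)
    (c a b : E₀ × E₁) : fderiv ℝ (prodMetric G₀ G₁) z c a b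
      = fderiv ℝ G₀ z.1 c.1 a.1 b.1 + fderiv ℝ G₁ z.2 c.2 a.2 b.2 := by
  have h₀ := d₀.differentiableAt one_ne_zero
  have h₁ := d₁.differentiableAt one_ne_zero
  have e0 : ∀ v w, HasFDerivAt (fun u => G₀ u v w) (((fderiv ℝ G₀ z.1).flip v).flip w) z.1 :=
    fun v w => by
      have := hasFDerivAt_clm_apply_const (hasFDerivAt_clm_apply_const h₀ v).differentiableAt w
      rwa [(hasFDerivAt_clm_apply_const h₀ v).fderiv] at this
  have e1 : ∀ v w, HasFDerivAt (fun u => G₁ u v w) (((fderiv ℝ G₁ z.2).flip v).flip w) z.2 :=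
    fun v w => by
      have := hasFDerivAt_clm_apply_const (hasFDerivAt_clm_apply_const h₁ v).differentiableAt w
      rwa [(hasFDerivAt_clm_apply_const h₁ v).fderiv] at this
  have hd : DifferentiableAt ℝ (prodMetric G₀ G₁) z := by
    refine ContDiffAt.differentiableAt (n := 1) (contDiffAt_of_clm_apply fun a =>
      contDiffAt_of_clm_apply fun b => ?_) one_ne_zero
    simp only [prodMetric_apply]
    have c0 : ContDiffAt ℝ 1 (fun u => G₀ u a.1 b.1) z.1 :=
      (d₀.clm_apply contDiffAt_const).clm_apply contDiffAt_const
    have c1 : ContDiffAt ℝ 1 (fun u => G₁ u a.2 b.2) z.2 :=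
      (d₁.clm_apply contDiffAt_const).clm_apply contDiffAt_const
    exact (c0.comp z contDiffAt_fst).add (c1.comp z contDiffAt_snd)
  have e2 := hasFDerivAt_clm_apply_const (hasFDerivAt_clm_apply_const hd a).differentiableAt b
  rw [(hasFDerivAt_clm_apply_const hd a).fderiv] at e2
  have e3 : HasFDerivAt (fun u => prodMetric G₀ G₁ u a b) _ z :=
    (((e0 a.1 b.1).comp z hasFDerivAt_fst).add
      ((e1 a.2 b.2).comp z hasFDerivAt_snd)).congr_of_eventuallyEq
        (Eventually.of_forall fun u => prodMetric_apply a b)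
  have := congrArg (fun T => T c) (e2.unique e3)
  simpa using this

theorem isInvertible_prodMetric (h₀ : (G₀ z.1).IsInvertible) (h₁ : (G₁ z.2).IsInvertible) :
    (prodMetric G₀ G₁ z).IsInvertible := by
  refine isInvertible_of_nondegenerate fun v hv => Prod.ext (h₀.injective ?_) (h₁.injective ?_)
  · ext w
    simpa [prodMetric_apply] using hv (w, 0)
  · ext w
    simpa [prodMetric_apply] using hv (0, w)

theorem christoffel_prodMetric (d₀ : ContDiffAt ℝ 1 G₀ z.1) (d₁ : ContDiffAt ℝ 1 G₁ z.2)
    (h₀ : (G₀ z.1).IsInvertible) (h₁ : (G₁ z.2).IsInvertible) (X Y : E₀ × E₁) :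
    christoffel (prodMetric G₀ G₁) z X Y
      = (christoffel G₀ z.1 X.1 Y.1, christoffel G₁ z.2 X.2 Y.2) := by
  rw [christoffel_eq_iff (isInvertible_prodMetric h₀ h₁)]
  intro Z
  simp only [prodMetric_apply, christoffel_spec h₀, christoffel_spec h₁, christoffelFirst_apply,
    fderiv_prodMetric_apply d₀ d₁]
  ring

/-- The Christoffel symbols split on a whole neighbourhood, so their derivatives split too. -/
theorem localCurvature_prodMetric (d₀ : ContDiffAt ℝ ∞ G₀ z.1) (d₁ : ContDiffAt ℝ ∞ G₁ z.2)
    (h₀ : (G₀ z.1).IsInvertible) (h₁ : (G₁ z.2).IsInvertible) (X Y Z : E₀ × E₁) :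
    localCurvature (prodMetric G₀ G₁) z X Y Z
      = (localCurvature G₀ z.1 X.1 Y.1 Z.1, localCurvature G₁ z.2 X.2 Y.2 Z.2) := by
  have := FiniteDimensional.complete ℝ E₀
  have := FiniteDimensional.complete ℝ E₁
  have near : ∀ᶠ w in 𝓝 z, ∀ X Y : E₀ × E₁, christoffel (prodMetric G₀ G₁) w X Y
      = (christoffel G₀ w.1 X.1 Y.1, christoffel G₁ w.2 X.2 Y.2) := by
    have t0 : Tendsto (Prod.fst : E₀ × E₁ → E₀) (𝓝 z) (𝓝 z.1) := continuousAt_fst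
    have t1 : Tendsto (Prod.snd : E₀ × E₁ → E₁) (𝓝 z) (𝓝 z.2) := continuousAt_snd
    filter_upwards [t0.eventually ((d₀.of_le (m := 1) (by norm_cast)).eventually (by simp)),
      t1.eventually ((d₁.of_le (m := 1) (by norm_cast)).eventually (by simp)),
      t0.eventually (eventually_isInvertible d₀.continuousAt h₀),
      t1.eventually (eventually_isInvertible d₁.continuousAt h₁)] with w w1 w2 w3 w4 X Y
    exact christoffel_prodMetric w1 w2 w3 w4 X Y
  have hder : ∀ A B C : E₀ × E₁, fderiv ℝ (fun w => christoffel (prodMetric G₀ G₁) w B C) z A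
      = (fderiv ℝ (fun w => christoffel G₀ w B.1 C.1) z.1 A.1,
        fderiv ℝ (fun w => christoffel G₁ w B.2 C.2) z.2 A.2) := by
    intro A B C
    have e0 := (differentiableAt_christoffel d₀ h₀ B.1 C.1).hasFDerivAt.comp z hasFDerivAt_fst
    have e1 := (differentiableAt_christoffel d₁ h₁ B.2 C.2).hasFDerivAt.comp z hasFDerivAt_snd
    rw [((e0.prodMk e1).congr_of_eventuallyEq (near.mono fun w hw => hw B C)).fderiv]
    simp
  simp only [localCurvature, hder, near.self_of_nhds, Prod.mk_add_mk, Prod.mk_sub_mk]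

variable {V : Type*} [NormedAddCommGroup V] [InnerProductSpace ℝ V]

/-- A conformal hypersurface of a product whose second fundamental form is not adapted to the
product at a point has factors of constant opposite curvatures at this point. -/
theorem exists_curvature_eq_of_not_adapted
    (hE₀ : 2 ≤ Module.finrank ℝ E₀) (hE₁ : 2 ≤ Module.finrank ℝ E₁)
    {h : E₀ × E₁ → V} {φ : E₀ × E₁ → ℝ} (hh : ContDiffAt ℝ ∞ h z) (hφ : ContDiffAt ℝ ∞ φ z)
    (hφ0 : 0 < φ z)
    (hG : ∀ᶠ w in 𝓝 z, ∀ a b, inner ℝ (fderiv ℝ h w a) (fderiv ℝ h w b)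
      = φ w ^ 2 * (G₀ w.1 a.1 b.1 + G₁ w.2 a.2 b.2))
    (hpos₀ : ∀ v, v ≠ 0 → 0 < G₀ z.1 v v) (hpos₁ : ∀ v, v ≠ 0 → 0 < G₁ z.2 v v)
    (hsymm₀ : ∀ v w, G₀ z.1 v w = G₀ z.1 w v) (hsymm₁ : ∀ v w, G₁ z.2 v w = G₁ z.2 w v)
    {N : V} (hN1 : inner ℝ N N = (1 : ℝ))
    (hN : ∀ a, inner ℝ (fderiv ℝ h z a) N = 0)
    (hspan : ∀ v, (∀ a, inner ℝ v (fderiv ℝ h z a) = 0) → inner ℝ v N = 0 → v = 0)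
    {x : E₀} {y : E₁} (hxy : inner ℝ (fderiv ℝ (fderiv ℝ h) z (x, 0) (0, y)) N ≠ 0) :
    ∃ κ : ℝ,
      (∀ i j, G₀ z.1 (localCurvature G₀ z.1 i j j) i
        = κ * (G₀ z.1 i i * G₀ z.1 j j - G₀ z.1 i j ^ 2)) ∧
      (∀ a b, G₁ z.2 (localCurvature G₁ z.2 a b b) a
        = -κ * (G₁ z.2 a a * G₁ z.2 b b - G₁ z.2 a b ^ 2)) := by
  have : Nontrivial E₀ := Module.finrank_pos_iff (R := ℝ).1 (by omega)
  have hpos : ∀ v, v ≠ 0 → 0 < prodMetric G₀ G₁ z v v := fun v hv => by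
    rw [prodMetric_apply]
    have n0 : 0 ≤ G₀ z.1 v.1 v.1 := by
      by_cases h0 : v.1 = 0
      · simp [h0]
      · exact (hpos₀ _ h0).le
    by_cases h1 : v.2 = 0
    · have h0 : v.1 ≠ 0 := fun h0 => hv (Prod.ext h0 h1)
      simpa [h1] using hpos₀ _ h0
    · linarith [hpos₁ _ h1]
  obtain ⟨hGs, B, S, hB, hBs, hSs, hR'⟩ := exists_conformal_gauss (G := prodMetric G₀ G₁) hh hφ hφ0
    (by simpa only [prodMetric_apply] using hG) hpos hN1 hN hspan
  simp only [localCurvature_prodMetric (contDiffAt_fst_of_prodMetric hGs)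
    (contDiffAt_snd_of_prodMetric hGs) (isInvertible_of_pos hpos₀) (isInvertible_of_pos hpos₁),
    prodMetric_apply] at hR'
  let L₀ := LinearMap.inl ℝ E₀ E₁
  let L₁ := LinearMap.inr ℝ E₀ E₁
  -- The four algebraic hypotheses are the vanishing of the curvature on arguments of types 0011,
  -- 0110, 0001 and 1110, where the digits name the factors.
  obtain ⟨κ, h0, h1⟩ := exists_constant_opposite_curvature hE₀ hE₁
    (G₀ z.1).toLinearMap₁₂ (B.compl₁₂ L₀ L₀) (S.compl₁₂ L₀ L₀)
    (G₁ z.2).toLinearMap₁₂ (B.compl₁₂ L₁ L₁) (S.compl₁₂ L₁ L₁)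
    (B.compl₁₂ L₀ L₁) (S.compl₁₂ L₀ L₁) hpos₀ hpos₁ hsymm₀ hsymm₁
    (fun v w => by simpa using hBs _ _) (fun v w => by simpa using hBs _ _)
    (fun i j a b => by
      have := hR' (i, 0) (j, 0) (0, a) (0, b)
      simp [localCurvature_zero_left, localCurvature_zero_right] at this
      simp [L₀, L₁]
      linarith)
    (fun i j a b => by
      have := hR' (i, 0) (0, a) (0, b) (j, 0)
      simp [localCurvature_zero_left, localCurvature_zero_right] at this
      simp [L₀, L₁]
      rw [hBs (0, a) (j, 0)] at this
      linarith)
    (fun i j k a => by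
      have := hR' (i, 0) (j, 0) (k, 0) (0, a)
      simp [localCurvature_zero_right] at this
      simp [L₀, L₁]
      linarith)
    (fun i a b c => by
      have := hR' (0, a) (0, b) (0, c) (i, 0)
      simp [localCurvature_zero_right] at this
      simp [L₀, L₁]
      rw [hBs (0, a) (i, 0), hBs (0, b) (i, 0), hSs (0, a) (i, 0), hSs (0, b) (i, 0)] at this
      linarith)
    (x := x) (y := y) (by
      simp only [LinearMap.compl₁₂_apply, L₀, L₁, LinearMap.inl_apply, LinearMap.inr_apply, hB]
      exact mul_ne_zero (inv_ne_zero hφ0.ne') hxy)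
  refine ⟨κ, fun i j => ?_, fun a b => ?_⟩
  · have e1 := hR' (i, 0) (j, 0) (j, 0) (i, 0)
    have e2 := h0 i j
    simp [localCurvature_zero_left] at e1
    simp [L₀] at e2
    rw [hBs (j, 0) (i, 0), hSs (j, 0) (i, 0), hsymm₀ j i] at e1
    linarith
  · have e1 := hR' (0, a) (0, b) (0, b) (0, a)
    have e2 := h1 a b
    simp [localCurvature_zero_left] at e1
    simp [L₁] at e2
    rw [hBs (0, b) (0, a), hSs (0, b) (0, a), hsymm₁ b a] at e1
    linarith

end LocalProduct

/-! ### Maps on manifolds read in the preferred chart -/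

section Manifold

open Filter Topology

variable {E : Type*} [NormedAddCommGroup E] [NormedSpace ℝ E] {H : Type*} [TopologicalSpace H]
  {I : ModelWithCorners ℝ E H} [I.Boundaryless]
  {M : Type*} [TopologicalSpace M] [ChartedSpace H M]
  {F : Type*} [NormedAddCommGroup F] [InnerProductSpace ℝ F]

theorem differential_eq_fderiv {f : M → F} (hf : ContMDiff I 𝓘(ℝ, F) ∞ f) (x : M) (a : E) :
    differential I f x a = fderiv ℝ (f ∘ (extChartAt I x).symm) (extChartAt I x x) a := by
  have h1 := (hf.contMDiffAt (x := x)).mdifferentiableAt (by simp)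
  have h2 : fderivWithin ℝ (writtenInExtChartAt I 𝓘(ℝ, F) x f) (Set.range I) (extChartAt I x x) a
      = fderiv ℝ (f ∘ (extChartAt I x).symm) (extChartAt I x x) a := by
    rw [I.range_eq_univ, fderivWithin_univ]
    rfl
  exact (congrArg (fun T : E →L[ℝ] F => T a) h1.mfderiv).trans h2

variable [IsManifold I ∞ M]

theorem contMDiffAt_extChartAt_symm {x : M} {y : E} (hy : y ∈ (extChartAt I x).target) :
    ContMDiffAt 𝓘(ℝ, E) I ∞ (extChartAt I x).symm y :=
  (contMDiffOn_extChartAt_symm x).contMDiffAt ((isOpen_extChartAt_target x).mem_nhds hy)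

theorem mdifferentiableAt_extChartAt_symm {x : M} {y : E} (hy : y ∈ (extChartAt I x).target) :
    MDifferentiableAt 𝓘(ℝ, E) I (extChartAt I x).symm y :=
  (contMDiffAt_extChartAt_symm hy).mdifferentiableAt (by simp)

theorem contDiffAt_comp_extChartAt_symm {f : M → F} (hf : ContMDiff I 𝓘(ℝ, F) ∞ f) (x : M) :
    ContDiffAt ℝ ∞ (f ∘ (extChartAt I x).symm) (extChartAt I x x) :=
  contMDiffAt_iff_contDiffAt.1
    (hf.contMDiffAt.comp _ (contMDiffAt_extChartAt_symm (mem_extChartAt_target x)))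

/-- In the preferred chart at `x` the differential of the inverse of the chart is the identity
of `T_x M`. -/
theorem mfderiv_extChartAt_symm_self (x : M) (v : E) :
    mfderiv 𝓘(ℝ, E) I (extChartAt I x).symm (extChartAt I x x) v = v := by
  have hd := mdifferentiableAt_extChartAt_symm (I := I) (mem_extChartAt_target (I := I) x)
  have h1 : (writtenInExtChartAt 𝓘(ℝ, E) I (extChartAt I x x) (extChartAt I x).symm)
      =ᶠ[𝓝 (extChartAt I x x)] id := by
    filter_upwards [extChartAt_target_mem_nhds (I := I) x] with z hz
    simp only [writtenInExtChartAt, extChartAt_to_inv, extChartAt_model_space_eq_id,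
      PartialEquiv.refl_symm, PartialEquiv.refl_coe, Function.comp_id, Function.comp_apply, id]
    exact (extChartAt I x).right_inv hz
  have h2 : fderivWithin ℝ (writtenInExtChartAt 𝓘(ℝ, E) I (extChartAt I x x)
      (extChartAt I x).symm) (Set.range 𝓘(ℝ, E)) (extChartAt I x x) v = v := by
    rw [modelWithCornersSelf_coe, Set.range_id, fderivWithin_univ, h1.fderiv_eq, fderiv_id]
    rfl
  exact (congrArg (fun T : E →L[ℝ] E => T v) hd.mfderiv).trans h2

theorem fderiv_comp_extChartAt_symm {f : M → F} (hf : ContMDiff I 𝓘(ℝ, F) ∞ f) {x : M} {y : E}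
    (hy : y ∈ (extChartAt I x).target) (a : E) :
    fderiv ℝ (f ∘ (extChartAt I x).symm) y a
      = differential I f ((extChartAt I x).symm y)
        (mfderiv 𝓘(ℝ, E) I (extChartAt I x).symm y a) := by
  have := mfderiv_comp_apply (I := 𝓘(ℝ, E)) (I' := I) (I'' := 𝓘(ℝ, F)) y (g := f)
    (f := (extChartAt I x).symm) (hf.contMDiffAt.mdifferentiableAt (by simp))
    (mdifferentiableAt_extChartAt_symm hy) a
  rw [mfderiv_eq_fderiv] at this
  exact this

end Manifold

/-! ### Sectional curvature in the preferred chart -/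

section Chart

variable {n : ℕ} {M : Type*} [TopologicalSpace M] [ChartedSpace (EuclideanSpace ℝ (Fin n)) M]
  [IsManifold (𝓡 n) ∞ M]
  (g : Bundle.ContMDiffRiemannianMetric (𝓡 n) ∞ (EuclideanSpace ℝ (Fin n))
    (fun p : M => TangentSpace (𝓡 n) p))

theorem chartMetric_apply (x : M) (y a b : EuclideanSpace ℝ (Fin n)) :
    chartMetric g x y a b = metricAt g ((extChartAt (𝓡 n) x).symm y)
      (chartSymmDeriv x y a) (chartSymmDeriv x y b) := by
  simp [chartMetric]

theorem chartMetric_self (x : M) (a b : EuclideanSpace ℝ (Fin n)) :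
    chartMetric g x (extChartAt (𝓡 n) x x) a b = g.inner x a b := by
  have h : ∀ v, chartSymmDeriv x (extChartAt (𝓡 n) x x) v = v :=
    fun v => mfderiv_extChartAt_symm_self x v
  rw [chartMetric_apply, h, h, extChartAt_to_inv]
  rfl

/-- The hypothesis covers every pair of vectors, so any basis of the plane will do; its Gram
determinant is nonzero and cancels. -/
theorem IsSectionalCurvature.eq_of_forall {g} {x : M} {V : Submodule ℝ (TangentSpace (𝓡 n) x)}
    {K κ : ℝ} (hK : IsSectionalCurvature g x V K)
    (h : ∀ i j, chartMetric g x (extChartAt (𝓡 n) x x)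
        (localCurvature (chartMetric g x) (extChartAt (𝓡 n) x x) i j j) i
      = κ * (chartMetric g x (extChartAt (𝓡 n) x x) i i * chartMetric g x (extChartAt (𝓡 n) x x) j j
        - chartMetric g x (extChartAt (𝓡 n) x x) i j ^ 2)) : K = κ := by
  obtain ⟨X, Y, hXY, -, rfl⟩ := hK
  simp only [chartMetric_self] at h
  have h1 : g.inner x (curvature g x X Y Y) X
      = κ * (g.inner x X X * g.inner x Y Y - g.inner x X Y ^ 2) := h X Y
  have h2 : 0 < g.inner x X X * g.inner x Y Y - g.inner x X Y ^ 2 :=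
    gram_det_pos (E := TangentSpace (𝓡 n) x) (g.inner x).toLinearMap₁₂
      (fun v hv => g.pos x v hv) (fun v w => g.symm x v w) hXY
  rw [h1, mul_div_assoc, div_self h2.ne', mul_one]

end Chart

/-! ### The product chart and the unit normal -/

section ProductChart

open Filter Topology

variable {n₀ n₁ : ℕ}
  {M₀ : Type*} [TopologicalSpace M₀] [ChartedSpace (EuclideanSpace ℝ (Fin n₀)) M₀]
  [IsManifold (𝓡 n₀) ∞ M₀]
  {M₁ : Type*} [TopologicalSpace M₁] [ChartedSpace (EuclideanSpace ℝ (Fin n₁)) M₁]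
  [IsManifold (𝓡 n₁) ∞ M₁]
  (g₀ : Bundle.ContMDiffRiemannianMetric (𝓡 n₀) ∞ (EuclideanSpace ℝ (Fin n₀))
    (fun p : M₀ => TangentSpace (𝓡 n₀) p))
  (g₁ : Bundle.ContMDiffRiemannianMetric (𝓡 n₁) ∞ (EuclideanSpace ℝ (Fin n₁))
    (fun p : M₁ => TangentSpace (𝓡 n₁) p))

/-- The preferred chart of the product is the product of charts, so projection commutes with its
inverse; apply the chain rule to both factorizations. -/
theorem mfderiv_fst_extChartAt_symm {x : M₀ × M₁}
    {z : EuclideanSpace ℝ (Fin n₀) × EuclideanSpace ℝ (Fin n₁)}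
    (hz : z ∈ (extChartAt ((𝓡 n₀).prod (𝓡 n₁)) x).target)
    (a : EuclideanSpace ℝ (Fin n₀) × EuclideanSpace ℝ (Fin n₁)) :
    mfderiv ((𝓡 n₀).prod (𝓡 n₁)) (𝓡 n₀) Prod.fst
        ((extChartAt ((𝓡 n₀).prod (𝓡 n₁)) x).symm z)
        (mfderiv 𝓘(ℝ, EuclideanSpace ℝ (Fin n₀) × EuclideanSpace ℝ (Fin n₁))
          ((𝓡 n₀).prod (𝓡 n₁)) (extChartAt ((𝓡 n₀).prod (𝓡 n₁)) x).symm z a)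
      = chartSymmDeriv x.1 z.1 a.1 := by
  have hz' : z.1 ∈ (extChartAt (𝓡 n₀) x.1).target := by
    rw [extChartAt_prod] at hz
    exact hz.1
  have e1 := mfderiv_comp_apply
    (I := 𝓘(ℝ, EuclideanSpace ℝ (Fin n₀) × EuclideanSpace ℝ (Fin n₁)))
    (I' := (𝓡 n₀).prod (𝓡 n₁)) (I'' := 𝓡 n₀) z (g := (Prod.fst : M₀ × M₁ → M₀))
    (f := (extChartAt ((𝓡 n₀).prod (𝓡 n₁)) x).symm) mdifferentiableAt_fst
    (mdifferentiableAt_extChartAt_symm hz) a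
  have e2 := mfderiv_comp_apply
    (I := 𝓘(ℝ, EuclideanSpace ℝ (Fin n₀) × EuclideanSpace ℝ (Fin n₁)))
    (I' := 𝓘(ℝ, EuclideanSpace ℝ (Fin n₀))) (I'' := 𝓡 n₀) z
    (g := (extChartAt (𝓡 n₀) x.1).symm) (f := Prod.fst) (mdifferentiableAt_extChartAt_symm hz')
    differentiableAt_fst.mdifferentiableAt a
  have e3 : (Prod.fst : M₀ × M₁ → M₀) ∘ (extChartAt ((𝓡 n₀).prod (𝓡 n₁)) x).symm
      = (extChartAt (𝓡 n₀) x.1).symm ∘ Prod.fst := by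
    rw [extChartAt_prod]
    rfl
  rw [mfderiv_eq_fderiv, fderiv_fst] at e2
  rw [e3] at e1
  exact e1.symm.trans e2

theorem mfderiv_snd_extChartAt_symm {x : M₀ × M₁}
    {z : EuclideanSpace ℝ (Fin n₀) × EuclideanSpace ℝ (Fin n₁)}
    (hz : z ∈ (extChartAt ((𝓡 n₀).prod (𝓡 n₁)) x).target)
    (a : EuclideanSpace ℝ (Fin n₀) × EuclideanSpace ℝ (Fin n₁)) :
    mfderiv ((𝓡 n₀).prod (𝓡 n₁)) (𝓡 n₁) Prod.snd
        ((extChartAt ((𝓡 n₀).prod (𝓡 n₁)) x).symm z)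
        (mfderiv 𝓘(ℝ, EuclideanSpace ℝ (Fin n₀) × EuclideanSpace ℝ (Fin n₁))
          ((𝓡 n₀).prod (𝓡 n₁)) (extChartAt ((𝓡 n₀).prod (𝓡 n₁)) x).symm z a)
      = chartSymmDeriv x.2 z.2 a.2 := by
  have hz' : z.2 ∈ (extChartAt (𝓡 n₁) x.2).target := by
    rw [extChartAt_prod] at hz
    exact hz.2
  have e1 := mfderiv_comp_apply
    (I := 𝓘(ℝ, EuclideanSpace ℝ (Fin n₀) × EuclideanSpace ℝ (Fin n₁)))
    (I' := (𝓡 n₀).prod (𝓡 n₁)) (I'' := 𝓡 n₁) z (g := (Prod.snd : M₀ × M₁ → M₁))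
    (f := (extChartAt ((𝓡 n₀).prod (𝓡 n₁)) x).symm) mdifferentiableAt_snd
    (mdifferentiableAt_extChartAt_symm hz) a
  have e2 := mfderiv_comp_apply
    (I := 𝓘(ℝ, EuclideanSpace ℝ (Fin n₀) × EuclideanSpace ℝ (Fin n₁)))
    (I' := 𝓘(ℝ, EuclideanSpace ℝ (Fin n₁))) (I'' := 𝓡 n₁) z
    (g := (extChartAt (𝓡 n₁) x.2).symm) (f := Prod.snd) (mdifferentiableAt_extChartAt_symm hz')
    differentiableAt_snd.mdifferentiableAt a
  have e3 : (Prod.snd : M₀ × M₁ → M₁) ∘ (extChartAt ((𝓡 n₀).prod (𝓡 n₁)) x).symm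
      = (extChartAt (𝓡 n₁) x.2).symm ∘ Prod.snd := by
    rw [extChartAt_prod]
    rfl
  rw [mfderiv_eq_fderiv, fderiv_snd] at e2
  rw [e3] at e1
  exact e1.symm.trans e2

theorem productMetric_extChartAt_symm {x : M₀ × M₁}
    {z : EuclideanSpace ℝ (Fin n₀) × EuclideanSpace ℝ (Fin n₁)}
    (hz : z ∈ (extChartAt ((𝓡 n₀).prod (𝓡 n₁)) x).target)
    (a b : EuclideanSpace ℝ (Fin n₀) × EuclideanSpace ℝ (Fin n₁)) :
    productMetric g₀ g₁ ((extChartAt ((𝓡 n₀).prod (𝓡 n₁)) x).symm z)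
        (mfderiv 𝓘(ℝ, EuclideanSpace ℝ (Fin n₀) × EuclideanSpace ℝ (Fin n₁))
          ((𝓡 n₀).prod (𝓡 n₁)) (extChartAt ((𝓡 n₀).prod (𝓡 n₁)) x).symm z a)
        (mfderiv 𝓘(ℝ, EuclideanSpace ℝ (Fin n₀) × EuclideanSpace ℝ (Fin n₁))
          ((𝓡 n₀).prod (𝓡 n₁)) (extChartAt ((𝓡 n₀).prod (𝓡 n₁)) x).symm z b)
      = chartMetric g₀ x.1 z.1 a.1 b.1 + chartMetric g₁ x.2 z.2 a.2 b.2 := by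
  have e : (extChartAt ((𝓡 n₀).prod (𝓡 n₁)) x).symm z
      = ((extChartAt (𝓡 n₀) x.1).symm z.1, (extChartAt (𝓡 n₁) x.2).symm z.2) := by
    rw [extChartAt_prod]
    rfl
  rw [productMetric, mfderiv_fst_extChartAt_symm hz, mfderiv_fst_extChartAt_symm hz,
    mfderiv_snd_extChartAt_symm hz, mfderiv_snd_extChartAt_symm hz, chartMetric_apply,
    chartMetric_apply]
  -- `metricAt` has values in forms on the fixed model space, which lets the base point be rewritten
  -- without transporting tangent vectors.
  change metricAt g₀ _ _ _ + metricAt g₁ _ _ _ = _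
  rw [e]

/-- A hyperplane in a Euclidean space has a unit normal vector, which spans its orthogonal
complement. -/
theorem exists_unit_normal {V : Type*} [NormedAddCommGroup V] [InnerProductSpace ℝ V]
    [FiniteDimensional ℝ V] (T : Submodule ℝ V)
    (hT : Module.finrank ℝ T + 1 = Module.finrank ℝ V) :
    ∃ N ∈ Tᗮ, inner ℝ N N = (1 : ℝ) ∧ ∀ v ∈ Tᗮ, ∃ c : ℝ, v = c • N := by
  have h1 : Module.finrank ℝ Tᗮ = 1 := by
    have := T.finrank_add_finrank_orthogonal
    omega
  obtain ⟨v, hv0, hv⟩ := finrank_eq_one_iff'.1 h1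
  have hv0' : (v : V) ≠ 0 := fun h => hv0 (Subtype.ext h)
  have hn : ‖(v : V)‖ ≠ 0 := norm_ne_zero_iff.2 hv0'
  refine ⟨‖(v : V)‖⁻¹ • (v : V), Submodule.smul_mem _ _ v.2, ?_, fun w hw => ?_⟩
  · rw [real_inner_smul_left, real_inner_smul_right, real_inner_self_eq_norm_sq]
    field_simp
  · obtain ⟨c, hc⟩ := hv ⟨w, hw⟩
    refine ⟨c * ‖(v : V)‖, ?_⟩
    rw [smul_smul, mul_assoc, mul_inv_cancel₀ hn, mul_one]
    exact (congrArg Subtype.val hc).symm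

end ProductChart

end ConformalProduct

end

/-! ### The theorem, proved in the product chart at `x` -/

theorem mainTheorem4 {n₀ n₁ : ℕ} (hn₀ : 2 ≤ n₀) (hn₁ : 2 ≤ n₁)
    {M₀ : Type*} [TopologicalSpace M₀] [ChartedSpace (EuclideanSpace ℝ (Fin n₀)) M₀]
    [IsManifold (𝓡 n₀) ∞ M₀]
    {M₁ : Type*} [TopologicalSpace M₁] [ChartedSpace (EuclideanSpace ℝ (Fin n₁)) M₁]
    [IsManifold (𝓡 n₁) ∞ M₁]
    (g₀ : Bundle.ContMDiffRiemannianMetric (𝓡 n₀) ∞ (EuclideanSpace ℝ (Fin n₀))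
      (fun p : M₀ => TangentSpace (𝓡 n₀) p))
    (g₁ : Bundle.ContMDiffRiemannianMetric (𝓡 n₁) ∞ (EuclideanSpace ℝ (Fin n₁))
      (fun p : M₁ => TangentSpace (𝓡 n₁) p))
    (f : M₀ × M₁ → EuclideanSpace ℝ (Fin (n₀ + n₁ + 1)))
    (hf : ConformalProduct.IsConformalImmersion ((𝓡 n₀).prod (𝓡 n₁))
      (ConformalProduct.productMetric g₀ g₁) f)
    (x : M₀ × M₁)
    (V₀ : Submodule ℝ (TangentSpace (𝓡 n₀) x.1)) (V₁ : Submodule ℝ (TangentSpace (𝓡 n₁) x.2))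
    (K₀ K₁ : ℝ)
    (hK₀ : ConformalProduct.IsSectionalCurvature g₀ x.1 V₀ K₀)
    (hK₁ : ConformalProduct.IsSectionalCurvature g₁ x.2 V₁ K₁)
    (hK : K₀ + K₁ ≠ 0) :
    ∀ (X₀ : TangentSpace (𝓡 n₀) x.1) (X₁ : TangentSpace (𝓡 n₁) x.2),
      ConformalProduct.secondFundamentalForm ((𝓡 n₀).prod (𝓡 n₁)) f x
        (ConformalProduct.tangentPair x X₀ 0) (ConformalProduct.tangentPair x 0 X₁) = 0 := by
  intro X₀ X₁
  obtain ⟨hfs, φ, hφs, hφ0, hφ⟩ := hf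
  let I := (𝓡 n₀).prod (𝓡 n₁)
  let E := EuclideanSpace ℝ (Fin n₀) × EuclideanSpace ℝ (Fin n₁)
  obtain ⟨y, hy⟩ : ∃ y : E, y = extChartAt I x x := ⟨_, rfl⟩
  have hy0 : y.1 = extChartAt (𝓡 n₀) x.1 x.1 := by rw [hy, extChartAt_prod]; rfl
  have hy1 : y.2 = extChartAt (𝓡 n₁) x.2 x.2 := by rw [hy, extChartAt_prod]; rfl
  obtain ⟨h, hh⟩ : ∃ h : E → EuclideanSpace ℝ (Fin (n₀ + n₁ + 1)),
      h = f ∘ (extChartAt I x).symm := ⟨_, rfl⟩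
  have hhs : ContDiffAt ℝ ∞ h y := by
    rw [hh, hy]; exact ConformalProduct.contDiffAt_comp_extChartAt_symm hfs x
  have hφs' : ContDiffAt ℝ ∞ (φ ∘ (extChartAt I x).symm) y := by
    rw [hy]; exact ConformalProduct.contDiffAt_comp_extChartAt_symm hφs x
  have hG : ∀ᶠ w in nhds y, ∀ a b, inner ℝ (fderiv ℝ h w a) (fderiv ℝ h w b)
      = (φ ∘ (extChartAt I x).symm) w ^ 2
        * (ConformalProduct.chartMetric g₀ x.1 w.1 a.1 b.1
          + ConformalProduct.chartMetric g₁ x.2 w.2 a.2 b.2) := by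
    rw [hy]
    filter_upwards [extChartAt_target_mem_nhds (I := I) x] with w hw a b
    rw [hh, ConformalProduct.fderiv_comp_extChartAt_symm hfs hw,
      ConformalProduct.fderiv_comp_extChartAt_symm hfs hw, hφ,
      ConformalProduct.productMetric_extChartAt_symm g₀ g₁ hw]
    rfl
  have hpos₀ : ∀ v, v ≠ 0 → 0 < ConformalProduct.chartMetric g₀ x.1 y.1 v v := fun v hv => by
    rw [hy0, ConformalProduct.chartMetric_self]
    exact g₀.pos x.1 v hv
  have hpos₁ : ∀ v, v ≠ 0 → 0 < ConformalProduct.chartMetric g₁ x.2 y.2 v v := fun v hv => by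
    rw [hy1, ConformalProduct.chartMetric_self]
    exact g₁.pos x.2 v hv
  have hsymm₀ : ∀ v w, ConformalProduct.chartMetric g₀ x.1 y.1 v w
      = ConformalProduct.chartMetric g₀ x.1 y.1 w v := fun v w => by
    rw [hy0, ConformalProduct.chartMetric_self, ConformalProduct.chartMetric_self]
    exact g₀.symm x.1 v w
  have hsymm₁ : ∀ v w, ConformalProduct.chartMetric g₁ x.2 y.2 v w
      = ConformalProduct.chartMetric g₁ x.2 y.2 w v := fun v w => by
    rw [hy1, ConformalProduct.chartMetric_self, ConformalProduct.chartMetric_self]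
    exact g₁.symm x.2 v w
  -- Conformality with a positive factor makes `dh` injective, so its image is a hyperplane and the
  -- normal space is a line.
  have hinj : Function.Injective (fderiv ℝ h y) := by
    rw [injective_iff_map_eq_zero]
    intro a ha
    have h1 := hG.self_of_nhds a a
    rw [ha, inner_zero_left] at h1
    have h2 := (mul_eq_zero.1 h1.symm).resolve_left (pow_ne_zero 2 (hφ0 _).ne')
    by_contra h0
    have n0 : 0 ≤ ConformalProduct.chartMetric g₀ x.1 y.1 a.1 a.1 := by
      by_cases h0 : a.1 = 0
      · simp [h0]
      · exact (hpos₀ _ h0).le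
    by_cases ha2 : a.2 = 0
    · have ha1 : a.1 ≠ 0 := fun ha1 => h0 (Prod.ext ha1 ha2)
      have := hpos₀ _ ha1
      simp [ha2] at h2
      linarith
    · linarith [hpos₁ _ ha2]
  have hrange : ConformalProduct.normalSpace I f x
      = (LinearMap.range (fderiv ℝ h y).toLinearMap)ᗮ := by
    rw [ConformalProduct.normalSpace]
    congr 2
    rw [hh, hy]
    exact LinearMap.ext fun a => ConformalProduct.differential_eq_fderiv hfs x a
  obtain ⟨N, hNT, hN1, hNs⟩ := ConformalProduct.exists_unit_normal
    (LinearMap.range (fderiv ℝ h y).toLinearMap) (by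
      rw [LinearMap.finrank_range_of_inj hinj]
      simp [E])
  have hN : ∀ a, inner ℝ (fderiv ℝ h y a) N = 0 := fun a =>
    (Submodule.mem_orthogonal _ _).1 hNT _ ⟨a, rfl⟩
  have hspan : ∀ v, (∀ a, inner ℝ v (fderiv ℝ h y a) = 0) → inner ℝ v N = 0 → v = 0 := by
    intro v hv hvN
    obtain ⟨c, rfl⟩ := hNs v ((Submodule.mem_orthogonal' _ _).2 (by
      rintro _ ⟨a, rfl⟩
      exact hv a))
    rw [real_inner_smul_left, hN1, mul_one] at hvN
    rw [hvN, zero_smul]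
  have key : inner ℝ (fderiv ℝ (fderiv ℝ h) y (X₀, 0) (0, X₁)) N = 0 := by
    by_contra hne
    obtain ⟨κ, h0, h1⟩ := ConformalProduct.exists_curvature_eq_of_not_adapted
      (by simpa using hn₀) (by simpa using hn₁) hhs hφs' (hφ0 _) hG hpos₀ hpos₁ hsymm₀ hsymm₁
      hN1 hN hspan hne
    rw [hy0] at h0
    rw [hy1] at h1
    apply hK
    rw [hK₀.eq_of_forall h0, hK₁.eq_of_forall h1]
    ring
  -- The normal projection vanishes as soon as the product with `N` does, because `N` spans the
  -- normal line.
  rw [ConformalProduct.secondFundamentalForm, Submodule.starProjection_apply_eq_zero_iff, hrange,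
    Submodule.mem_orthogonal]
  intro v hv
  obtain ⟨c, rfl⟩ := hNs v hv
  rw [hh, hy] at key
  rw [real_inner_smul_left, real_inner_comm]
  exact mul_eq_zero_of_right c key
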